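/- Theorem. Let $k \ge 0$ be a fixed integer. The restricted $k$-list colouring problem on $P_5$-free graphs can be solved in polynomial time. That is: there are a deterministic multi-stack (equivalently, multitape) Turing machine and a polynomial $p$, both depending only on $k$, with the following property. Let $G$ be any finite simple graph with no induced path on five vertices ($G$ need not be connected), and let each vertex $v$ of $G$ be given a list $l(v) \subseteq \{1,\dots,k\}$. On the input $(G,l)$, written as the adjacency matrix of $G$ together with the characteristic vectors of the lists $l(v)$, the machine halts after at most $p(N)$ steps, where $N$ is the length of the input, and correctly answers whether $G$ has a proper vertex colouring in which every vertex $v$ receives a colour from its list $l(v)$. -/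

import Mathlib

/-- `G` is `P₅`-free: no induced subgraph of `G` is a path on five vertices. -/
def SimpleGraph.IsP5Free {V : Type*} (G : SimpleGraph V) : Prop :=
  ¬ (SimpleGraph.pathGraph 5).IsIndContained G

/-- `G` has a proper colouring in which every vertex `v` receives a colour from its list `l v`. -/
def SimpleGraph.IsListColourable {V C : Type*} (G : SimpleGraph V) (l : V → Finset C) : Prop :=
  ∃ c : G.Coloring C, ∀ v, c v ∈ l v

/-- An instance of the restricted `k`-list colouring problem: a finite simple graph together with,
for each vertex, a list of colours that is a subset of one fixed set of `k` colours. The colours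
`1, …, k` are represented by the `k` elements of `Fin k`. -/
structure RestrictedListInstance (k : ℕ) where
  /-- the number of vertices -/
  n : ℕ
  /-- the graph -/
  graph : SimpleGraph (Fin n)
  /-- the colour lists -/
  lists : Fin n → Finset (Fin k)

namespace RestrictedListInstance

open Computability

variable {k : ℕ}

open Classical in
/-- The part of the input string that describes the vertex `v`: its row of the adjacency matrix,
a comma, the characteristic vector of its list, and an end marker. -/
noncomputable def encodeVertex (I : RestrictedListInstance k) (v : Fin I.n) : List Γ' :=
  (List.finRange I.n).map (fun w => Γ'.bit (decide (I.graph.Adj v w))) ++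
    Γ'.comma :: ((List.finRange k).map (fun c => Γ'.bit (decide (c ∈ I.lists v))) ++ [Γ'.ket])

/-- The input string for an instance, of length `n * (n + k + 2)`. -/
noncomputable def encode (I : RestrictedListInstance k) : List Γ' :=
  (List.finRange I.n).flatMap I.encodeVertex

theorem length_encodeVertex (I : RestrictedListInstance k) (v : Fin I.n) :
    (I.encodeVertex v).length = I.n + k + 2 := by
  simp [encodeVertex]
  omega

theorem length_encode (I : RestrictedListInstance k) :
    I.encode.length = I.n * (I.n + k + 2) := by
  simp [encode, List.length_flatMap, length_encodeVertex]

theorem flatMap_inj {α β : Type*} (f g : α → List β)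
    (h : ∀ a, (f a).length = (g a).length) (l : List α) (e : l.flatMap f = l.flatMap g) :
    ∀ a ∈ l, f a = g a := by
  induction l with
  | nil => simp
  | cons b l ih =>
    simp only [List.flatMap_cons] at e
    obtain ⟨h1, h2⟩ := List.append_inj e (h b)
    simpa [h1] using ih h2

/-- The input string determines the instance. -/
theorem encode_injective : Function.Injective (encode (k := k)) := by
  intro I J h
  have hn : I.n = J.n := by
    have hl := congrArg List.length h
    rw [length_encode, length_encode] at hl
    rcases lt_trichotomy I.n J.n with hlt | heq | hlt
    · nlinarith
    · exact heq
    · nlinarith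
  obtain ⟨n, G, l⟩ := I
  obtain ⟨m, G', l'⟩ := J
  obtain rfl : n = m := hn
  have key := flatMap_inj _ _ (fun v => by
    rw [length_encodeVertex, length_encodeVertex]) (List.finRange n) h
  have hv : ∀ v : Fin n, (∀ w, G.Adj v w ↔ G'.Adj v w) ∧ ∀ c, c ∈ l v ↔ c ∈ l' v := by
    intro v
    have e := key v (List.mem_finRange v)
    simp only [encodeVertex] at e
    obtain ⟨h1, h2⟩ := List.append_inj e (by simp)
    rw [List.cons.injEq] at h2
    have h3 := List.append_inj_left h2.2 (by simp)
    rw [List.map_inj_left] at h1 h3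
    exact ⟨fun w => by simpa using h1 w (List.mem_finRange w),
      fun c => by simpa using h3 c (List.mem_finRange c)⟩
  obtain rfl : G = G' := by
    ext v w
    exact (hv v).1 w
  obtain rfl : l = l' := by
    funext v
    ext c
    exact (hv v).2 c
  rfl

end RestrictedListInstance

open Classical in
/-- The decision problem `p`, on inputs `a : α` that are presented as the strings `enc a`, is
solved in polynomial time: some Turing machine, started on `enc a`, halts with the one-bit output
"does `p a` hold?" after a number of steps that is at most a fixed polynomial in the length of
`enc a`, for every `a : α`. -/
def DecidableInPolyTime {α Γ : Type} (enc : α → List Γ) (p : α → Prop) : Prop :=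
  Nonempty (Turing.TM2ComputableInPolyTime enc Computability.encodeBool (fun a => decide (p a)))

/-!
For fixed `k`, list colourability of `P₅`-free graphs is a first-order property of the instance, and
a first-order sentence is evaluated in polynomial time by nested loops over the vertices.

Why it is first-order. Suppose that a `P₅`-free graph has a proper colouring. For a vertex `d`, take
two colour classes, and in them the neighbours `x` and the non-neighbours `y` of `d`. Their
adjacencies are nested: edges `x y` and `x' y'` without the edges `x y'` and `x' y` would give the
induced path `y x d x' y'`. Hence a single `x` dominates all the `y` that are dominated at all
(`exists_dominator`). Three consequences follow.

* Every component is within distance three of each of its vertices, since a longer shortest path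
  would contain an induced path on five vertices. So components are definable (`InComp.adj`).
* One dominator for each pair of colours reaches the second neighbourhood of a root, and similar
  ones reach the third. So each component has a dominating set of size bounded in terms of `k`
  (`exists_dominating`).
* Guess the colours of a dominating set, and for each of its members `d` and each pair of colours a
  dominator as above, coloured with the first colour. Neighbours of guessed vertices lose the
  guessed colours. If after this an edge `v y`, with `v` adjacent to `d` and `y` not, has the colour
  `c` at both ends, then `v` cannot have colour `c`: otherwise the dominator guessed for `d`, `c`
  and the colour of `y` would have removed `c` from the list of `y`. So `c` can be removed from `v`,
  and thereafter two adjacent vertices whose neighbours in the dominating set differ have disjoint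
  lists.

What remains are independent problems on the neighbourhoods of the dominating vertices, and each has
lost a colour altogether. After `k` rounds nothing is left. This procedure is `Solvable`; it is
sound whatever is guessed (`Solvable.colourableOn`), and complete because a colouring provides
the guesses (`ColourableOn.solvable`).

The machine. A program (`Prog`) is a piece of code with one entry and one exit, and running times
are proved for it in every machine into which it is embedded (`Run`, `Does`). The variables of a
first-order formula are unary counters. Atomic formulas are decided by walking to the relevant
symbol of the input and back (`does_adj`, `does_mem`), and a quantifier is a loop over all values of
its counter (`does_search`). `Evaluable` says that a query has such a program, and
`Evaluable.solvable` derives it for `Solvable` from the closure under first-order operations.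
-/

namespace P5FreeColouring

open Sum Computability Turing StateTransition

section Graph

/-! ### The colouring algorithm as a predicate on graphs -/

variable {V C : Type*}

/-- The vertices satisfying `A` have a proper colouring in which each receives a colour from its
list; `L c v` says that `c` is in the list of `v`. -/
def ColourableOn (G : SimpleGraph V) (A : V → Prop) (L : C → V → Prop) : Prop :=
  ∃ f : V → C, (∀ v, A v → L (f v) v) ∧ ∀ v w, A v → A w → G.Adj v w → f v ≠ f w

/-- `v` is the end of a walk of length `t + 1` from `r` all of whose later vertices satisfy `A`. -/
def Near (G : SimpleGraph V) (A : V → Prop) (r : V) : ℕ → V → Prop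
  | 0, v => A v ∧ G.Adj r v
  | t + 1, v => A v ∧ ∃ z, Near G A r t z ∧ G.Adj z v

/-- `v` is the end of a walk of length one, two or three from `r` in `A`. In a `P₅`-free graph this
describes the component of `r` in the subgraph induced by `A`, unless `r` is isolated there. -/
def InComp (G : SimpleGraph V) (A : V → Prop) (r v : V) : Prop :=
  Near G A r 0 v ∨ Near G A r 1 v ∨ Near G A r 2 v

/-- Indices for the members of a dominating set of a component: the root, and one vertex at
distance one and one at distance two for every pair of colours. Where no such vertex is needed, the
member is arbitrary. -/
abbrev DomIndex (C : Type*) := Option (Bool × C × C)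

/-- Indices for the guessed vertices of one round: a dominating set, and for each of its members
and every pair of colours one more vertex. -/
abbrev GuessIndex (C : Type*) := DomIndex C ⊕ (DomIndex C × C × C)

/-- The lists that remain when each guessed vertex `u j` is believed to have the colour `g j`. -/
def Residual (G : SimpleGraph V) (L : C → V → Prop) (u : GuessIndex C → V) (g : GuessIndex C → C)
    (c : C) (v : V) : Prop :=
  L c v ∧ ∀ j, g j = c → ¬ G.Adj v (u j)

/-- The residual lists, pruned further: `v` loses `c` when it has a neighbour `y` in `B` that still
has `c`, and some member of the dominating set is adjacent to `v` but not to `y`. -/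
def Pruned (G : SimpleGraph V) (B : V → Prop) (L : C → V → Prop) (u : GuessIndex C → V)
    (g : GuessIndex C → C) (c : C) (v : V) : Prop :=
  Residual G L u g c v ∧ ¬ ∃ y, B y ∧ G.Adj v y ∧ Residual G L u g c y ∧
    ∃ i, G.Adj v (u (inl i)) ∧ ¬ G.Adj y (u (inl i))

/-- The outcome of `m` rounds of the colouring algorithm on the vertices satisfying `A`. One round
treats each component separately (the list of `r` is inspected because `InComp` misses `r` when `r`
is isolated): after guessing some vertices and their colours, it passes the neighbourhoods of the dominating vertices, with pruned lists, to the next round. -/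
def Solvable (G : SimpleGraph V) : ℕ → (V → Prop) → (C → V → Prop) → Prop
  | 0, A, _ => ∀ v, ¬ A v
  | m + 1, A, L => ∀ r, A r → (∃ c, L c r) ∧
      ∃ u : GuessIndex C → V, ∃ g : GuessIndex C → C,
        (∀ v, InComp G A r v → ∃ i, G.Adj v (u (inl i))) ∧
        ∀ i, Solvable G m (fun v => InComp G A r v ∧ G.Adj v (u (inl i)))
          (Pruned G (InComp G A r) L u g)

/-! ### Consequences of the absence of induced paths -/

theorem no_induced_path {G : SimpleGraph V} (hG : G.IsP5Free) {a b c d e : V}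
    (ab : G.Adj a b) (bc : G.Adj b c) (cd : G.Adj c d) (de : G.Adj d e)
    (ac : ¬ G.Adj a c) (ad : ¬ G.Adj a d) (ae : ¬ G.Adj a e) (bd : ¬ G.Adj b d)
    (be : ¬ G.Adj b e) (ce : ¬ G.Adj c e) : False := by
  apply hG
  have adj : ∀ i j : Fin 5, G.Adj (![a, b, c, d, e] i) (![a, b, c, d, e] j) ↔
      (SimpleGraph.pathGraph 5).Adj i j := by
    intro i j
    rw [SimpleGraph.pathGraph_adj]
    fin_cases i <;> fin_cases j <;>
      simp [ab, bc, cd, de, ac, ad, ae, bd, be, ce, ab.symm, bc.symm, cd.symm, de.symm,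
        G.adj_comm c a, G.adj_comm d a, G.adj_comm e a, G.adj_comm d b, G.adj_comm e b,
        G.adj_comm e c]
  refine ⟨⟨⟨![a, b, c, d, e], ?_⟩, fun {i j} => adj i j⟩⟩
  -- No two vertices of the path have the same neighbours, so the map is injective.
  have sep : ∀ i j : Fin 5, (∀ l, (SimpleGraph.pathGraph 5).Adj i l ↔
      (SimpleGraph.pathGraph 5).Adj j l) → i = j := by
    simp only [SimpleGraph.pathGraph_adj]
    decide
  intro i j hij
  refine sep i j fun l => ?_
  rw [← adj i l, ← adj j l]
  exact iff_of_eq (congrArg (fun x => G.Adj x _) hij)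

theorem Near.mem {G : SimpleGraph V} {A : V → Prop} {r v : V} :
    ∀ {t : ℕ}, Near G A r t v → A v
  | 0, h => h.1
  | _ + 1, h => h.1

theorem InComp.mem {G : SimpleGraph V} {A : V → Prop} {r v : V} (h : InComp G A r v) : A v := by
  rcases h with h | h | h <;> exact h.mem

/-- Walks of length at most three suffice, since a shortest walk of length four would be an
induced path on five vertices. -/
theorem InComp.adj {G : SimpleGraph V} (hG : G.IsP5Free) {A : V → Prop} {r v w : V}
    (h : InComp G A r v) (hw : A w) (hvw : G.Adj v w) : InComp G A r w := by
  rcases h with h | h | h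
  · exact Or.inr (Or.inl ⟨hw, v, h, hvw⟩)
  · exact Or.inr (Or.inr ⟨hw, v, h, hvw⟩)
  · obtain ⟨hv, b, ⟨hb, a, ⟨ha, ra⟩, ab⟩, bv⟩ := h
    by_contra hn
    have n0 : ¬ Near G A r 0 w := fun h => hn (Or.inl h)
    have n1 : ¬ Near G A r 1 w := fun h => hn (Or.inr (Or.inl h))
    have n2 : ¬ Near G A r 2 w := fun h => hn (Or.inr (Or.inr h))
    refine no_induced_path hG ra ab bv hvw ?_ ?_ ?_ ?_ ?_ ?_
    · exact fun rb => n2 ⟨hw, v, ⟨hv, b, ⟨hb, rb⟩, bv⟩, hvw⟩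
    · exact fun rv => n1 ⟨hw, v, ⟨hv, rv⟩, hvw⟩
    · exact fun rw => n0 ⟨hw, rw⟩
    · exact fun av => n2 ⟨hw, v, ⟨hv, a, ⟨ha, ra⟩, av⟩, hvw⟩
    · exact fun aw => n1 ⟨hw, a, ⟨ha, ra⟩, aw⟩
    · exact fun bw => n2 ⟨hw, b, ⟨hb, a, ⟨ha, ra⟩, ab⟩, bw⟩

/-- It suffices to colour the components one at a time. -/
theorem colourableOn_of_inComp [Nonempty C] {G : SimpleGraph V} (hG : G.IsP5Free) {A : V → Prop}
    {L : C → V → Prop}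
    (h : ∀ r, A r → (∃ c, L c r) ∧ ColourableOn G (InComp G A r) L) : ColourableOn G A L := by
  classical
  let H : SimpleGraph V :=
    { Adj := fun v w => G.Adj v w ∧ A v ∧ A w
      symm := ⟨fun v w h => ⟨h.1.symm, h.2.2, h.2.1⟩⟩
      loopless := ⟨fun v h => G.loopless.irrefl v h.1⟩ }
  have hA : ∀ r v, H.Reachable r v → A v → A r := by
    rintro r v ⟨p⟩ hv
    cases p with
    | nil => exact hv
    | cons e _ => exact e.2.1
  have hisol : ∀ r v, H.Reachable r v → (∀ y, ¬ (A y ∧ G.Adj r y)) → r = v := by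
    rintro r v ⟨p⟩ hr
    cases p with
    | nil => rfl
    | cons e _ => exact absurd ⟨e.2.2, e.1⟩ (hr _)
  have hcomp : ∀ r v, H.Reachable r v → A r → (∃ y, A y ∧ G.Adj r y) → InComp G A r v := by
    rintro r v hp hr ⟨y, hy, hry⟩
    rw [SimpleGraph.reachable_iff_reflTransGen] at hp
    induction hp with
    | refl => exact Or.inr (Or.inl ⟨hr, y, ⟨hy, hry⟩, hry.symm⟩)
    | tail _ e ih => exact ih.adj hG e.2.2 e.1
  have hcol : ∀ r, ∃ f : V → C, A r → (∀ v, H.Reachable r v → A v → L (f v) v) ∧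
      ∀ v w, H.Reachable r v → H.Reachable r w → A v → A w → G.Adj v w → f v ≠ f w := by
    intro r
    by_cases hr : A r
    · by_cases hi : ∀ y, ¬ (A y ∧ G.Adj r y)
      · obtain ⟨c, hc⟩ := (h r hr).1
        refine ⟨fun _ => c, fun _ => ⟨fun v hv _ => ?_, fun v w hv hw _ hw' hvw => ?_⟩⟩
        · rw [← hisol r v hv hi]; exact hc
        · rw [← hisol r v hv hi] at hvw
          exact absurd ⟨hw', hvw⟩ (hi w)
      · push Not at hi
        obtain ⟨f, hf, hf'⟩ := (h r hr).2
        exact ⟨f, fun _ => ⟨fun v hv _ => hf v (hcomp r v hv hr hi),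
          fun v w hv hw _ _ hvw => hf' v w (hcomp r v hv hr hi) (hcomp r w hw hr hi) hvw⟩⟩
    · exact ⟨fun _ => Classical.arbitrary C, fun h => absurd h hr⟩
  choose f hf using hcol
  -- Each component is coloured by the colouring that belongs to its chosen representative.
  let rep : V → V := fun v => (H.connectedComponentMk v).out
  have hrep : ∀ v, H.Reachable (rep v) v := fun v =>
    SimpleGraph.ConnectedComponent.exact (Quot.out_eq (H.connectedComponentMk v))
  refine ⟨fun v => f (rep v) v, fun v hv => (hf _ (hA _ _ (hrep v) hv)).1 v (hrep v) hv, ?_⟩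
  intro v w hv hw hvw
  have hr : rep v = rep w := by
    have : H.connectedComponentMk v = H.connectedComponentMk w :=
      SimpleGraph.ConnectedComponent.sound (SimpleGraph.Adj.reachable ⟨hvw, hv, hw⟩)
    simp only [rep, this]
  have := (hf _ (hA _ _ (hrep v) hv)).2 v w (hrep v) (hr ▸ hrep w) hv hw hvw
  simpa only [← hr] using this

/-- If the neighbourhoods in `Y` of the members of `X` are nested, then some member of `X` has
the largest one. -/
theorem exists_largest_nbhd [Finite V] (G : SimpleGraph V) {X Y : V → Prop} (hX : ∃ x, X x)
    (h : ∀ x x' y y', X x → X x' → Y y → Y y' → G.Adj x y → G.Adj x' y' → ¬ G.Adj x y' →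
      ¬ G.Adj x' y → False) :
    ∃ x, X x ∧ ∀ y, Y y → (∃ x', X x' ∧ G.Adj x' y) → G.Adj x y := by
  obtain ⟨x, hx, hmax⟩ := Set.exists_max_image {x | X x} (fun x => {y | Y y ∧ G.Adj x y}.ncard)
    (Set.toFinite _) hX
  refine ⟨x, hx, fun y hy ⟨x', hx', hxy⟩ => ?_⟩
  by_contra hn
  have hlt : {y | Y y ∧ G.Adj x y}.ncard < {y | Y y ∧ G.Adj x' y}.ncard := by
    refine Set.ncard_lt_ncard ⟨fun z hz => ⟨hz.1, ?_⟩, fun hs => hn (hs ⟨hy, hxy⟩).2⟩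
    by_contra hz'
    exact h x x' z y hx hx' hz.1 hy hz.2 hxy hn hz'
  exact absurd (hmax x' hx') (not_le.2 hlt)

/-- In a properly coloured `P₅`-free graph, let `d` be any vertex. Among the neighbours of `d` of
one colour, some vertex `x` dominates all those non-neighbours of `d` of another colour that are
dominated by any of them. -/
theorem exists_dominator [Finite V] {G : SimpleGraph V} (hG : G.IsP5Free) {A : V → Prop}
    {s : V → C} (hs : ∀ v w, A v → A w → G.Adj v w → s v ≠ s w) (d r : V) (hr : A r) (a b : C) :
    ∃ x, A x ∧ ((∃ x', A x' ∧ G.Adj d x' ∧ s x' = a) → G.Adj d x ∧ s x = a) ∧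
      ∀ y, A y → ¬ G.Adj d y → s y = b → (∃ x', A x' ∧ G.Adj d x' ∧ s x' = a ∧ G.Adj x' y) →
        G.Adj x y := by
  by_cases hX : ∃ x', A x' ∧ G.Adj d x' ∧ s x' = a
  · obtain ⟨x, hx, hmax⟩ := exists_largest_nbhd G (X := fun x => A x ∧ G.Adj d x ∧ s x = a)
      (Y := fun y => A y ∧ ¬ G.Adj d y ∧ s y = b) hX (by
        rintro x x' y y' ⟨hx, dx, sx⟩ ⟨hx', dx', sx'⟩ ⟨hy, dy, sy⟩ ⟨hy', dy', sy'⟩ xy xy' nxy nxy'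
        refine no_induced_path hG xy.symm dx.symm dx' xy' (fun h => dy h.symm)
          (fun h => nxy' h.symm) (fun h => hs y y' hy hy' h (sy.trans sy'.symm))
          (fun h => hs x x' hx hx' h (sx.trans sx'.symm)) nxy dy')
    refine ⟨x, hx.1, fun _ => hx.2, fun y hy dy sy ⟨x', h1, h2, h3, h4⟩ => ?_⟩
    exact hmax y ⟨hy, dy, sy⟩ ⟨x', ⟨h1, h2, h3⟩, h4⟩
  · exact ⟨r, hr, fun h => absurd h hX, fun y _ _ _ ⟨x', h1, h2, h3, _⟩ =>
      absurd ⟨x', h1, h2, h3⟩ hX⟩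

/-- The analogue of `exists_dominator` for the vertices at distance two and three from `r`: edges
`x y` and `x' y'` between them, without `x y'` and `x' y`, extend to an induced path on five vertices
through the neighbours of `r` that are adjacent to `x` or `x'`. -/
theorem exists_far_dominator [Finite V] {G : SimpleGraph V} (hG : G.IsP5Free) {A : V → Prop}
    {s : V → C} (hs : ∀ v w, A v → A w → G.Adj v w → s v ≠ s w) (r : V) (hr : A r) (a b : C) :
    ∃ x, A x ∧ ∀ y, A y → ¬ G.Adj r y → ¬ Near G A r 1 y → s y = b →
      (∃ x', Near G A r 1 x' ∧ ¬ G.Adj r x' ∧ s x' = a ∧ G.Adj x' y) → G.Adj x y := by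
  by_cases hX : ∃ x', Near G A r 1 x' ∧ ¬ G.Adj r x' ∧ s x' = a
  · obtain ⟨x, hx, hmax⟩ := exists_largest_nbhd G
      (X := fun x => Near G A r 1 x ∧ ¬ G.Adj r x ∧ s x = a)
      (Y := fun y => A y ∧ ¬ G.Adj r y ∧ ¬ Near G A r 1 y ∧ s y = b) hX (by
        rintro x x' y y' ⟨⟨hx, p, ⟨hp, rp⟩, px⟩, rx, sx⟩ ⟨⟨hx', p', ⟨hp', rp'⟩, px'⟩, rx', sx'⟩
          ⟨hy, ry, dy, sy⟩ ⟨hy', _, dy', sy'⟩ xy xy' nxy nxy'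
        have nxx : ¬ G.Adj x x' := fun h => hs x x' hx hx' h (sx.trans sx'.symm)
        have nyy : ¬ G.Adj y y' := fun h => hs y y' hy hy' h (sy.trans sy'.symm)
        have hfar : ∀ {z q}, A z → ¬ Near G A r 1 z → A q → G.Adj r q → ¬ G.Adj z q :=
          fun hz nz hq rq e => nz ⟨hz, _, ⟨hq, rq⟩, e.symm⟩
        by_cases h1 : G.Adj p x'
        · exact no_induced_path hG xy.symm px.symm h1 xy' (hfar hy dy hp rp)
            (fun h => nxy' h.symm) nyy nxx nxy (fun h => hfar hy' dy' hp rp h.symm)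
        by_cases h2 : G.Adj p' x
        · exact no_induced_path hG xy.symm h2.symm px' xy' (hfar hy dy hp' rp')
            (fun h => nxy' h.symm) nyy nxx nxy (fun h => hfar hy' dy' hp' rp' h.symm)
        by_cases h3 : G.Adj p p'
        · exact no_induced_path hG xy.symm px.symm h3 px' (hfar hy dy hp rp)
            (hfar hy dy hp' rp') (fun h => nxy' h.symm) (fun h => h2 h.symm) nxx h1
        · exact no_induced_path hG xy.symm px.symm rp.symm rp' (hfar hy dy hp rp)
            (fun h => ry h.symm) (hfar hy dy hp' rp') (fun h => rx h.symm) (fun h => h2 h.symm)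
            h3)
    exact ⟨x, hx.1.1, fun y hy ry dy sy ⟨x', h1, h2, h3, h4⟩ =>
      hmax y ⟨hy, ry, dy, sy⟩ ⟨x', ⟨h1, h2, h3⟩, h4⟩⟩
  · exact ⟨r, hr, fun y _ _ _ _ ⟨x', h1, h2, h3, _⟩ => absurd ⟨x', h1, h2, h3⟩ hX⟩

/-- Every component of a properly coloured `P₅`-free graph has a dominating set whose size is
bounded in terms of the number of colours. -/
theorem exists_dominating [Finite V] {G : SimpleGraph V} (hG : G.IsP5Free) {A : V → Prop}
    {s : V → C} (hs : ∀ v w, A v → A w → G.Adj v w → s v ≠ s w) (r : V) (hr : A r) :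
    ∃ d : DomIndex C → V, (∀ i, A (d i)) ∧ ∀ v, InComp G A r v → ∃ i, G.Adj v (d i) := by
  choose x hx _ hx2 using exists_dominator hG hs r r hr
  choose z hz hz' using exists_far_dominator hG hs r hr
  refine ⟨fun i => i.elim r fun p => if p.1 then z p.2.1 p.2.2 else x p.2.1 p.2.2, ?_, ?_⟩
  · rintro (_ | ⟨_ | _, a, b⟩)
    · exact hr
    · exact hx a b
    · exact hz a b
  · intro v hv
    by_cases h0 : G.Adj r v
    · exact ⟨none, h0.symm⟩
    by_cases h1 : Near G A r 1 v
    · obtain ⟨q, ⟨hq, rq⟩, qv⟩ := h1.2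
      exact ⟨some (false, s q, s v), (hx2 _ _ v h1.mem h0 rfl ⟨q, hq, rq, rfl, qv⟩).symm⟩
    rcases hv with h | h | h
    · exact absurd h.2 h0
    · exact absurd h h1
    · obtain ⟨hv, q, hq, qv⟩ := h
      exact ⟨some (true, s q, s v), (hz' _ _ v hv h0 h1 rfl
        ⟨q, hq, fun rq => h1 ⟨hv, q, ⟨hq.mem, rq⟩, qv⟩, rfl, qv⟩).symm⟩

/-! ### Correctness of the colouring algorithm -/

/-- Soundness, for which it does not matter whether the guesses were right. -/
theorem Solvable.colourableOn [Nonempty C] {G : SimpleGraph V} (hG : G.IsP5Free) :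
    ∀ {m : ℕ} {A : V → Prop} {L : C → V → Prop}, Solvable G m A L → ColourableOn G A L
  | 0, _, _, h => ⟨fun _ => Classical.arbitrary C, fun v hv => absurd hv (h v),
      fun v _ hv => absurd hv (h v)⟩
  | m + 1, A, L, h => by
    refine colourableOn_of_inComp hG fun r hr => ⟨(h r hr).1, ?_⟩
    obtain ⟨u, g, hdom, hsol⟩ := (h r hr).2
    have hcol := fun i => (hsol i).colourableOn hG
    choose f hf hf' using hcol
    -- A vertex is coloured as a neighbour of some dominating vertex, which is chosen as a function
    -- of the set of all its dominating neighbours.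
    have hsel : ∀ T : Set (DomIndex C), ∃ i, T.Nonempty → i ∈ T := fun T => by
      by_cases hT : T.Nonempty
      · exact ⟨hT.some, fun _ => hT.some_mem⟩
      · exact ⟨none, fun h => absurd h hT⟩
    choose sel hsel using hsel
    let T : V → Set (DomIndex C) := fun v => {i | G.Adj v (u (inl i))}
    have hT : ∀ v, InComp G A r v → G.Adj v (u (inl (sel (T v)))) := fun v hv =>
      hsel (T v) (hdom v hv)
    have hL : ∀ v (hv : InComp G A r v), Pruned G (InComp G A r) L u g (f (sel (T v)) v) v :=
      fun v hv => hf _ v ⟨hv, hT v hv⟩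
    -- Adjacent vertices that are separated by a dominating vertex have disjoint pruned lists.
    have hsep : ∀ v w, InComp G A r v → InComp G A r w → G.Adj v w →
        f (sel (T v)) v = f (sel (T w)) w → ∀ i, i ∈ T v → i ∈ T w := by
      intro v w hv hw hvw he i hi
      by_contra hn
      exact (hL v hv).2 ⟨w, hw, hvw, he ▸ (hL w hw).1, i, hi, hn⟩
    refine ⟨fun v => f (sel (T v)) v, fun v hv => (hL v hv).1.1, fun v w hv hw hvw he => ?_⟩
    have hTT : T v = T w := Set.Subset.antisymm (hsep v w hv hw hvw he)
      (hsep w v hw hv hvw.symm he.symm)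
    refine hf' (sel (T v)) v w ⟨hv, hT v hv⟩ ⟨hw, hTT ▸ hT w hw⟩ hvw ?_
    simpa only [← hTT] using he

/-- If at most `m` colours occur in the lists, then `m` rounds suffice: one round removes the
colour of the dominating vertex from all the lists of its neighbourhood. -/
theorem ColourableOn.solvable [Finite V] [Finite C] {G : SimpleGraph V} (hG : G.IsP5Free) :
    ∀ {m : ℕ} {A : V → Prop} {L : C → V → Prop}, {c | ∃ v, A v ∧ L c v}.ncard ≤ m →
      ColourableOn G A L → Solvable G m A L
  | 0, A, L, hm, ⟨s, hsL, _⟩ => by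
    intro v hv
    have h0 := (Set.ncard_eq_zero (Set.toFinite _)).1 (Nat.le_zero.1 hm)
    have : s v ∈ {c | ∃ v, A v ∧ L c v} := ⟨v, hv, hsL v hv⟩
    rw [h0] at this
    exact this
  | m + 1, A, L, hm, ⟨s, hsL, hs⟩ => by
    intro r hr
    refine ⟨⟨s r, hsL r hr⟩, ?_⟩
    obtain ⟨d, hdA, hd⟩ := exists_dominating hG hs r hr
    choose x hxA hxs hx using fun i => exists_dominator hG hs (d i) r hr
    let u : GuessIndex C → V := Sum.elim d fun p => x p.1 p.2.1 p.2.2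
    have huA : ∀ j, A (u j) := by
      rintro (i | ⟨i, a, b⟩)
      · exact hdA i
      · exact hxA i a b
    have hres : ∀ v, A v → Residual G L u (s ∘ u) (s v) v := fun v hv =>
      ⟨hsL v hv, fun j hj hvj => hs v (u j) hv (huA j) hvj hj.symm⟩
    have hpru : ∀ v, A v → Pruned G (InComp G A r) L u (s ∘ u) (s v) v := by
      refine fun v hv => ⟨hres v hv, ?_⟩
      rintro ⟨y, hy, hvy, hyL, i, hvi, hyi⟩
      -- The vertex guessed for `i` and the colours of `v` and `y` is adjacent to `y` and has the
      -- colour of `v`, so it has removed this colour from the list of `y`.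
      have hX : ∃ x', A x' ∧ G.Adj (d i) x' ∧ s x' = s v := ⟨v, hv, hvi.symm, rfl⟩
      have hxy : G.Adj (x i (s v) (s y)) y :=
        hx i _ _ y hy.mem (fun h => hyi h.symm) rfl ⟨v, hv, hvi.symm, rfl, hvy⟩
      exact hyL.2 (inr (i, s v, s y)) (hxs i _ _ hX).2 hxy.symm
    refine ⟨u, s ∘ u, hd, fun i => ColourableOn.solvable hG ?_
      ⟨s, fun v hv => hpru v hv.1.mem, fun v w hv hw => hs v w hv.1.mem hw.1.mem⟩⟩
    have hlt : {c | ∃ v, (InComp G A r v ∧ G.Adj v (u (inl i))) ∧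
        Pruned G (InComp G A r) L u (s ∘ u) c v}.ncard < {c | ∃ v, A v ∧ L c v}.ncard := by
      refine Set.ncard_lt_ncard ⟨?_, fun hsub => ?_⟩ (Set.toFinite _)
      · rintro c ⟨v, hv, hc⟩
        exact ⟨v, hv.1.mem, hc.1.1⟩
      · obtain ⟨v, hv, hc⟩ := hsub (a := s (u (inl i))) ⟨_, huA _, hsL _ (huA _)⟩
        exact hc.1.2 (inl i) rfl hv.2
    omega

end Graph

section Machine

/-! ### Stack machines and programs -/

/-- The work stacks of a machine with `R` variables: the unread part of the input, the part read
already, a scratch stack, and two unary counters for each variable. The value of a variable is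
the height of its left counter; together its two counters have as many entries as there are
vertices. -/
inductive Work (R : ℕ)
  | inp | back | tmp
  | left (i : Fin R)
  | right (i : Fin R)
  deriving DecidableEq, Fintype

/-- The stacks of a machine: the output stack `none` and the work stacks. -/
abbrev Stack (R : ℕ) := Option (Work R)

/-- The alphabets of the stacks. -/
@[reducible]
def Alphabet (R : ℕ) : Stack R → Type
  | none => Bool
  | some _ => Γ'

/-- The internal state of a machine: the last symbol read, if any, and the current truth value. -/
abbrev Reg := Option Γ' × Bool

/-- The contents of the work stacks. -/
abbrev Mem (R : ℕ) := Work R → List Γ'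

variable {R : ℕ}

/-- The contents of all stacks, when the output stack is empty. -/
def Mem.full (S : Mem R) : ∀ k, List (Alphabet R k)
  | none => []
  | some w => S w

theorem Mem.update_full (S : Mem R) (w : Work R) (l : List Γ') :
    Function.update S.full (some w) l = Mem.full (Function.update S w l) := by
  funext k
  rcases k with _ | k
  · exact Function.update_of_ne (by simp) _ _
  · by_cases h : k = w
    · subst h
      exact (Function.update_self (some k) l S.full).trans (Function.update_self k l S).symm
    · refine (Function.update_of_ne (β := fun k => List (Alphabet R k))
        (fun e => h (Option.some.inj e)) l S.full).trans ?_
      exact (Function.update_of_ne h l S).symm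

/-- A program with a single entry and a single exit. Its code is a piece of the program of any
machine into whose set `Λ` of labels its own labels are embedded. -/
structure Prog (R : ℕ) where
  /-- the labels of the program -/
  Lab : Type
  /-- there are finitely many labels -/
  fin : Fintype Lab
  /-- the label at which the program starts -/
  entry : Lab
  /-- the code, for given names of the labels and of the exit -/
  code : ∀ {Λ : Type}, (Lab → Λ) → Λ → Lab → TM2.Stmt (Alphabet R) Λ Reg

/-- The program `p` leads from the registers and stacks `a` to `b` in at most `T` steps, in
whichever machine it is embedded. -/
def Run (p : Prog R) (a b : Reg × Mem R) (T : ℕ) : Prop :=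
  ∀ ⦃Λ : Type⦄ (M : Λ → TM2.Stmt (Alphabet R) Λ Reg) (emb : p.Lab → Λ) (exit : Λ),
    (∀ l, M (emb l) = p.code emb exit l) →
    Nonempty (EvalsToInTime (TM2.step M) ⟨some (emb p.entry), a.1, a.2.full⟩
      (some ⟨some exit, b.1, b.2.full⟩) T)

theorem evalsToInTime_mono {α : Type*} {f : α → Option α} {a : α} {b : Option α} {m n : ℕ}
    (h : Nonempty (EvalsToInTime f a b m)) (hmn : m ≤ n) : Nonempty (EvalsToInTime f a b n) :=
  h.elim fun h => ⟨⟨h.toEvalsTo, h.steps_le_m.trans hmn⟩⟩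

theorem evalsToInTime_trans {α : Type*} {f : α → Option α} {a b : α} {c : Option α} {m n : ℕ}
    (h : Nonempty (EvalsToInTime f a (some b) m)) (h' : Nonempty (EvalsToInTime f b c n)) :
    Nonempty (EvalsToInTime f a c (m + n)) :=
  h.elim fun h => h'.elim fun h' => evalsToInTime_mono ⟨EvalsToInTime.trans f _ _ a b c h h'⟩
    (Nat.add_comm n m).le

theorem evalsToInTime_step {α : Type*} {f : α → Option α} {a : α} {b : Option α}
    (h : f a = b) : Nonempty (EvalsToInTime f a b 1) :=
  ⟨⟨⟨1, by simpa [flip] using h⟩, le_rfl⟩⟩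

theorem Run.mono {p : Prog R} {a b : Reg × Mem R} {T T' : ℕ} (h : Run p a b T) (hT : T ≤ T') :
    Run p a b T' :=
  fun _ M emb exit hM => evalsToInTime_mono (h M emb exit hM) hT

/-! ### Structured programs -/

/-- A program with one label. -/
def Prog.single (q : ∀ {Λ : Type}, Λ → TM2.Stmt (Alphabet R) Λ Reg) : Prog R where
  Lab := Unit
  fin := inferInstance
  entry := ()
  code _ exit _ := q exit

/-- Apply a function to the registers. -/
def Prog.act (f : Reg → Reg) : Prog R := .single fun exit => .load f (.goto fun _ => exit)

/-- Read the top of a stack. -/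
def Prog.peek (w : Work R) : Prog R :=
  .single fun exit => .peek (some w) (fun v x => (x, v.2)) (.goto fun _ => exit)

/-- Test whether the next input symbol is the bit one. -/
def Prog.readBit : Prog R :=
  .single fun exit => .peek (some .inp)
    (fun v (x : Option Γ') => (v.1, decide (x = some (Γ'.bit true)))) (.goto fun _ => exit)

/-- Pop a stack. -/
def Prog.drop (w : Work R) : Prog R :=
  .single fun exit => .pop (some w) (fun v x => (x, v.2)) (.goto fun _ => exit)

/-- Push a counter token. -/
def Prog.push (w : Work R) : Prog R :=
  .single fun exit => .push (some w) (fun _ => Γ'.blank) (.goto fun _ => exit)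

/-- Move the top symbol of the stack `w`, if there is one, to the stack `x`. -/
def Prog.move (w x : Work R) : Prog R :=
  .single fun exit => .pop (some w) (fun v y => (y, v.2))
    (.branch (fun v => v.1.isSome)
      (.push (some x) (fun v => v.1.getD Γ'.blank) (.goto fun _ => exit)) (.goto fun _ => exit))

/-- Sequential composition. -/
def Prog.seq (p q : Prog R) : Prog R where
  Lab := p.Lab ⊕ q.Lab
  fin := letI := p.fin; letI := q.fin; inferInstance
  entry := .inl p.entry
  code emb exit
    | .inl l => p.code (fun l => emb (.inl l)) (emb (.inr q.entry)) l
    | .inr l => q.code (fun l => emb (.inr l)) exit l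

/-- Conditional execution. -/
def Prog.cond (c : Reg → Bool) (p : Prog R) : Prog R where
  Lab := Option p.Lab
  fin := letI := p.fin; inferInstance
  entry := none
  code emb exit
    | none => .goto fun v => if c v then emb (some p.entry) else exit
    | some l => p.code (fun l => emb (some l)) exit l

/-- A while loop. -/
def Prog.loop (c : Reg → Bool) (p : Prog R) : Prog R where
  Lab := Option p.Lab
  fin := letI := p.fin; inferInstance
  entry := none
  code emb exit
    | none => .goto fun v => if c v then emb (some p.entry) else exit
    | some l => p.code (fun l => emb (some l)) (emb none) l

theorem run_single {q : ∀ {Λ : Type}, Λ → TM2.Stmt (Alphabet R) Λ Reg} {a b : Reg × Mem R}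
    (h : ∀ {Λ : Type} (exit : Λ), TM2.stepAux (q exit) a.1 a.2.full =
      ⟨some exit, b.1, b.2.full⟩) : Run (.single q) a b 1 := by
  intro Λ M emb exit hM
  refine evalsToInTime_step ?_
  rw [TM2.step, hM]
  exact congrArg some (h exit)

theorem run_act (f : Reg → Reg) (v : Reg) (S : Mem R) : Run (.act f) (v, S) (f v, S) 1 :=
  run_single fun _ => rfl

theorem run_peek (w : Work R) (v : Reg) (S : Mem R) :
    Run (.peek w) (v, S) (((S w).head?, v.2), S) 1 :=
  run_single fun _ => rfl

theorem run_readBit (v : Reg) (S : Mem R) :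
    Run .readBit (v, S) ((v.1, decide ((S .inp).head? = some (Γ'.bit true))), S) 1 :=
  run_single fun _ => rfl

theorem run_drop (w : Work R) (v : Reg) (S : Mem R) :
    Run (.drop w) (v, S) (((S w).head?, v.2), Function.update S w (S w).tail) 1 :=
  run_single fun _ => by
    simp only [TM2.stepAux]
    rw [← Mem.update_full]
    rfl

theorem run_push (w : Work R) (v : Reg) (S : Mem R) :
    Run (.push w) (v, S) (v, Function.update S w (Γ'.blank :: S w)) 1 :=
  run_single fun _ => by
    simp only [TM2.stepAux]
    rw [← Mem.update_full]
    rfl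

theorem run_move_nil {w x : Work R} (v : Reg) {S : Mem R} (hS : S w = []) :
    Run (.move w x) (v, S) ((none, v.2), S) 1 :=
  run_single fun _ => by
    have h : S.full (some w) = [] := hS
    have hu : Function.update S.full (some w) [] = S.full := by
      rw [← h, Function.update_eq_self]
    simp only [TM2.stepAux, h]
    exact congrArg (TM2.Cfg.mk _ _) hu

theorem run_move_cons {w x : Work R} (hwx : w ≠ x) (v : Reg) {S : Mem R} {y : Γ'} {l : List Γ'}
    (hS : S w = y :: l) :
    Run (.move w x) (v, S)
      ((some y, v.2), Function.update (Function.update S w l) x (y :: S x)) 1 :=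
  run_single fun _ => by
    have h : S.full (some w) = y :: l := hS
    have hu : Function.update (Function.update S.full (some w) l) (some x)
        (y :: (Function.update S.full (some w) l (some x))) =
          Mem.full (Function.update (Function.update S w l) x (y :: S x)) := by
      rw [Mem.update_full, Mem.update_full]
      congr 3
      exact Function.update_of_ne hwx.symm _ _
    simp only [TM2.stepAux, h]
    exact congrArg (TM2.Cfg.mk _ _) hu

theorem Run.seq {p q : Prog R} {a b c : Reg × Mem R} {T T' : ℕ} (hp : Run p a b T)
    (hq : Run q b c T') : Run (p.seq q) a c (T + T') := by
  intro Λ M emb exit hM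
  exact evalsToInTime_trans
    (hp M (fun l => emb (.inl l)) (emb (.inr q.entry)) fun l => hM (.inl l))
    (hq M (fun l => emb (.inr l)) exit fun l => hM (.inr l))

theorem run_cond_true {c : Reg → Bool} {p : Prog R} {a b : Reg × Mem R} {T : ℕ}
    (hc : c a.1 = true) (hp : Run p a b T) : Run (p.cond c) a b (1 + T) := by
  intro Λ M emb exit hM
  refine evalsToInTime_trans (b := ⟨some (emb (some p.entry)), a.1, a.2.full⟩)
    (evalsToInTime_step ?_) (hp M (fun l => emb (some l)) exit fun l => hM (some l))
  change some (TM2.stepAux (M (emb none)) _ _) = _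
  rw [hM none]
  simp [Prog.cond, hc]

theorem run_cond_false {c : Reg → Bool} {p : Prog R} {a : Reg × Mem R}
    (hc : c a.1 = false) : Run (p.cond c) a a 1 := by
  intro Λ M emb exit hM
  refine evalsToInTime_step ?_
  change some (TM2.stepAux (M (emb none)) _ _) = _
  rw [hM none]
  simp [Prog.cond, hc]

theorem run_loop_true {c : Reg → Bool} {p : Prog R} {a b d : Reg × Mem R} {T T' : ℕ}
    (hc : c a.1 = true) (hp : Run p a b T) (hl : Run (p.loop c) b d T') :
    Run (p.loop c) a d (1 + T + T') := by
  intro Λ M emb exit hM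
  refine evalsToInTime_trans (evalsToInTime_trans
    (b := ⟨some (emb (some p.entry)), a.1, a.2.full⟩) (evalsToInTime_step ?_)
      (hp M (fun l => emb (some l)) (emb none) fun l => hM (some l))) (hl M emb exit hM)
  change some (TM2.stepAux (M (emb none)) _ _) = _
  rw [hM none]
  simp [Prog.loop, hc]

theorem run_loop_false {c : Reg → Bool} {p : Prog R} {a : Reg × Mem R}
    (hc : c a.1 = false) : Run (p.loop c) a a 1 := by
  intro Λ M emb exit hM
  refine evalsToInTime_step ?_
  change some (TM2.stepAux (M (emb none)) _ _) = _
  rw [hM none]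
  simp [Prog.loop, hc]

/-- The program `p` changes the stacks `S` to `S'` and the truth value `b` to `b'` in at most `T`
steps, whatever the last symbol read. -/
def Does (p : Prog R) (b : Bool) (S : Mem R) (b' : Bool) (S' : Mem R) (T : ℕ) : Prop :=
  ∀ x, ∃ x', Run p ((x, b), S) ((x', b'), S') T

theorem Does.mono {p : Prog R} {b b' : Bool} {S S' : Mem R} {T T' : ℕ} (h : Does p b S b' S' T)
    (hT : T ≤ T') : Does p b S b' S' T' :=
  fun x => (h x).imp fun _ h => h.mono hT

theorem Does.seq {p q : Prog R} {b b' b'' : Bool} {S S' S'' : Mem R} {T T' : ℕ}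
    (hp : Does p b S b' S' T) (hq : Does q b' S' b'' S'' T') :
    Does (p.seq q) b S b'' S'' (T + T') := by
  intro x
  obtain ⟨x', h⟩ := hp x
  obtain ⟨x'', h'⟩ := hq x'
  exact ⟨x'', h.seq h'⟩

theorem does_act (f : Bool → Bool) (b : Bool) (S : Mem R) :
    Does (.act fun v => (v.1, f v.2)) b S (f b) S 1 :=
  fun _ => ⟨_, run_act _ _ _⟩

/-- Execute `q` only if the truth value after `p` is one. -/
theorem Does.and {p q : Prog R} {b : Bool} {S : Mem R} {T T' : ℕ} {P Q : Prop} [Decidable P]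
    [Decidable Q] (hp : Does p b S (decide P) S T) (hq : Does q true S (decide Q) S T') :
    Does (p.seq (q.cond fun v => v.2)) b S (decide (P ∧ Q)) S (T + (1 + T')) := by
  refine hp.seq fun x => ?_
  by_cases hP : P
  · obtain ⟨x', h⟩ := hq x
    simp only [hP, decide_true, true_and]
    exact ⟨x', run_cond_true rfl h⟩
  · simp only [hP, decide_false, false_and]
    exact ⟨x, (run_cond_false rfl).mono (by omega)⟩

/-! ### Moving symbols between stacks -/

/-- Move the whole stack `w` to the stack `x`, in reverse order. -/
def Prog.moveAll (w x : Work R) : Prog R :=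
  .seq (.act fun v => (some Γ'.blank, v.2)) (.loop (fun v => v.1.isSome) (.move w x))

theorem does_moveAll {w x : Work R} (hwx : w ≠ x) (b : Bool) (S : Mem R) :
    Does (.moveAll w x) b S b
      (Function.update (Function.update S w []) x ((S w).reverse ++ S x))
      (2 * (S w).length + 4) := by
  have key : ∀ (l : List Γ') (S : Mem R) (y : Γ'), S w = l →
      Run (.loop (fun v => v.1.isSome) (.move w x)) ((some y, b), S)
        ((none, b), Function.update (Function.update S w []) x (l.reverse ++ S x))
        (2 * l.length + 3) := by
    intro l
    induction l with
    | nil =>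
      intro S y hS
      have h : Function.update (Function.update S w []) x (([] : List Γ').reverse ++ S x) = S := by
        
        simp only [List.reverse_nil, List.nil_append]
        rw [← hS, Function.update_eq_self, Function.update_eq_self]
      rw [h]
      exact run_loop_true rfl (run_move_nil _ hS) (run_loop_false rfl)
    | cons z l ih =>
      intro S y hS
      have h := ih (Function.update (Function.update S w l) x (z :: S x)) z (by simp [hwx])
      refine Run.mono (run_loop_true rfl (run_move_cons hwx _ hS) ?_)
        (T := 1 + 1 + (2 * l.length + 3)) (by simp; omega)
      convert h using 2
      simp only [Function.update_self, List.reverse_cons, List.append_assoc, List.singleton_append]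
      funext k
      simp only [Function.update_apply]
      split_ifs <;> simp_all
  intro y
  refine ⟨none, ?_⟩
  refine ((run_act _ _ _).seq (key (S w) S Γ'.blank rfl)).mono (by omega)

/-- Empty the stack `w`. -/
def Prog.clear (w : Work R) : Prog R :=
  .seq (.act fun v => (some Γ'.blank, v.2)) (.loop (fun v => v.1.isSome) (.drop w))

theorem does_clear (w : Work R) (b : Bool) (S : Mem R) :
    Does (.clear w) b S b (Function.update S w []) (2 * (S w).length + 4) := by
  have key : ∀ (l : List Γ') (S : Mem R) (y : Γ'), S w = l →
      Run (.loop (fun v => v.1.isSome) (.drop w)) ((some y, b), S)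
        ((none, b), Function.update S w []) (2 * l.length + 3) := by
    intro l
    induction l with
    | nil =>
      intro S y hS
      have h := run_drop w (some y, b) S
      rw [hS] at h
      exact run_loop_true rfl h (run_loop_false rfl)
    | cons z l ih =>
      intro S y hS
      have h := run_drop w (some y, b) S
      rw [hS] at h
      have h' := ih (Function.update S w l) z (by simp)
      rw [Function.update_idem] at h'
      exact (run_loop_true rfl h h').mono (by simp; omega)
  intro y
  exact ⟨none, ((run_act _ _ _).seq (key (S w) S Γ'.blank rfl)).mono (by omega)⟩

/-- The unary representation of a number. -/
def unary (n : ℕ) : List Γ' := List.replicate n Γ'.blank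

@[simp] theorem length_unary (n : ℕ) : (unary n).length = n := List.length_replicate

@[simp] theorem reverse_unary (n : ℕ) : (unary n).reverse = unary n := List.reverse_replicate ..

theorem unary_succ (n : ℕ) : unary (n + 1) = Γ'.blank :: unary n := rfl

@[simp] theorem unary_zero : unary 0 = [] := rfl

theorem unary_append (m n : ℕ) : unary m ++ unary n = unary (m + n) :=
  List.replicate_append_replicate ..

/-- Execute `p` once for every token on the stack `w`, moving the tokens to the stack `x`. -/
def Prog.forEach (w x : Work R) (p : Prog R) : Prog R :=
  .seq (.move w x) (.loop (fun v => v.1.isSome) (.seq p (.move w x)))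

/-- Execution of a counting loop, where `F i` is the memory after `i` executions of its body, apart
from the two stacks that hold the counter. -/
theorem does_forEach {w x : Work R} (hwx : w ≠ x) {p : Prog R} {b : Bool} {n c : ℕ}
    (F : ℕ → Mem R)
    (hF : ∀ i j, i + j + 1 = n → Does p b
      (Function.update (Function.update (F i) w (unary j)) x (unary (i + 1))) b
      (Function.update (Function.update (F (i + 1)) w (unary j)) x (unary (i + 1))) c) :
    Does (.forEach w x p) b (Function.update (Function.update (F 0) w (unary n)) x []) b
      (Function.update (Function.update (F n) w []) x (unary n)) (n * (c + 2) + 2) := by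
  have mv : ∀ (i j : ℕ) (G : Mem R) (v : Reg),
      Run (.move w x) (v, Function.update (Function.update G w (unary (j + 1))) x (unary i))
        ((some Γ'.blank, v.2), Function.update (Function.update G w (unary j)) x (unary (i + 1)))
        1 := by
    intro i j G v
    have h := run_move_cons hwx v (S := Function.update (Function.update G w (unary (j + 1))) x
      (unary i)) (y := Γ'.blank) (l := unary j) (by simp [hwx, unary_succ])
    convert h using 2
    funext k
    simp only [Function.update_apply]
    split_ifs <;> simp_all [unary_succ]
  have mv0 : ∀ (i : ℕ) (G : Mem R) (v : Reg),
      Run (.move w x) (v, Function.update (Function.update G w []) x (unary i))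
        ((none, v.2), Function.update (Function.update G w []) x (unary i)) 1 := fun i G v =>
    run_move_nil v (by simp [hwx])
  have key : ∀ j i, i + j + 1 = n →
      Run (.loop (fun v => v.1.isSome) (.seq p (.move w x)))
        ((some Γ'.blank, b),
          Function.update (Function.update (F i) w (unary j)) x (unary (i + 1)))
        ((none, b), Function.update (Function.update (F n) w []) x (unary n))
        ((j + 1) * (c + 2) + 1) := by
    intro j
    induction j with
    | zero =>
      intro i hi
      obtain ⟨y, hy⟩ := hF i 0 hi (some Γ'.blank)
      obtain rfl : i + 1 = n := by omega
      exact (run_loop_true rfl (hy.seq (mv0 _ _ _)) (run_loop_false rfl)).mono (by omega)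
    | succ j ih =>
      intro i hi
      obtain ⟨y, hy⟩ := hF i (j + 1) hi (some Γ'.blank)
      exact (run_loop_true rfl (hy.seq (mv _ _ _ _)) (ih (i + 1) (by omega))).mono
        (by ring_nf; omega)
  intro y
  refine ⟨none, ?_⟩
  rcases n with _ | n
  · exact ((mv0 0 (F 0) (y, b)).seq (run_loop_false rfl)).mono (by omega)
  · exact ((mv 0 n (F 0) (y, b)).seq (key n 0 (by omega))).mono (by omega)

end Machine

section Evaluation

variable {R k : ℕ}

/-! ### Reading the input -/

/-- The memory `S` with the input split into the part `p` read already and the part `q` to be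
read. -/
def seek (S : Mem R) (p q : List Γ') : Mem R :=
  Function.update (Function.update S .inp q) .back p.reverse

theorem seek_update {S : Mem R} {p q l : List Γ'} {w : Work R} (h : w ≠ .inp) (h' : w ≠ .back) :
    Function.update (seek S p q) w l = seek (Function.update S w l) p q := by
  unfold seek
  rw [Function.update_comm h'.symm, Function.update_comm h.symm]

theorem seek_inp (S : Mem R) (p q : List Γ') : seek S p q .inp = q := rfl

theorem seek_nil {S : Mem R} {q : List Γ'} (h : S .inp = q) (h' : S .back = []) :
    seek S [] q = S := by
  unfold seek
  rw [← h, Function.update_eq_self, List.reverse_nil, ← h', Function.update_eq_self]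

theorem run_move_seek (S : Mem R) (v : Reg) (p q : List Γ') (y : Γ') :
    Run (.move .inp .back) (v, seek S p (y :: q)) ((some y, v.2), seek S (p ++ [y]) q) 1 := by
  have h := run_move_cons (w := .inp) (x := .back) (by simp) v
    (S := seek S p (y :: q)) (y := y) (l := q) rfl
  convert h using 2
  funext w
  cases w <;> simp [seek]

theorem does_move_seek (S : Mem R) (b : Bool) (p q : List Γ') (y : Γ') :
    Does (.move .inp .back) b (seek S p (y :: q)) b (seek S (p ++ [y]) q) 1 :=
  fun _ => ⟨_, run_move_seek S _ p q y⟩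

/-- Return to the start of the input. -/
def Prog.rewind : Prog R := .moveAll .back .inp

theorem does_rewind (S : Mem R) (b : Bool) (p q : List Γ') :
    Does .rewind b (seek S p q) b (seek S [] (p ++ q)) (2 * p.length + 4) := by
  have h := does_moveAll (w := .back) (x := .inp) (by simp) b (seek S p q)
  have e : seek S p q .back = p.reverse := Function.update_self ..
  rw [e, List.reverse_reverse, List.length_reverse, seek_inp] at h
  have e' : Function.update (Function.update (seek S p q) .back []) .inp (p ++ q) =
      seek S [] (p ++ q) := by
    funext w
    cases w <;> simp [seek]
  exact e' ▸ h

/-- Skip the input up to and including the next symbol `y`. -/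
def Prog.skipTo (y : Γ') : Prog R :=
  .seq (.act fun v => (none, v.2)) (.loop (fun v => v.1 != some y) (.move .inp .back))

theorem does_skipTo (S : Mem R) (b : Bool) (p q : List Γ') {y : Γ'} {l : List Γ'} (hl : y ∉ l) :
    Does (.skipTo y) b (seek S p (l ++ y :: q)) b (seek S (p ++ l ++ [y]) q)
      (2 * l.length + 4) := by
  have key : ∀ (l p : List Γ') (x : Option Γ'), y ∉ l → x ≠ some y →
      Run (.loop (fun v => v.1 != some y) (.move .inp .back)) ((x, b), seek S p (l ++ y :: q))
        ((some y, b), seek S (p ++ l ++ [y]) q) (2 * l.length + 3) := by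
    intro l
    induction l with
    | nil =>
      intro p x _ hx
      have h := run_loop_true (c := fun v : Reg => v.1 != some y) (by simpa using hx)
        (run_move_seek S (x, b) p q y) (run_loop_false (by simp))
      simpa using h
    | cons z l ih =>
      intro p x hy hx
      rw [List.mem_cons, not_or] at hy
      have h := run_loop_true (c := fun v : Reg => v.1 != some y) (by simpa using hx)
        (run_move_seek S (x, b) p (l ++ y :: q) z)
        (ih (p ++ [z]) (some z) hy.2 (by simpa using fun e => hy.1 e.symm))
      refine Run.mono ?_ (T := 1 + 1 + (2 * l.length + 3)) (by simp; omega)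
      simpa using h
  intro x
  exact ⟨some y, ((run_act _ _ _).seq (key l p none hl (by simp))).mono (by omega)⟩

/-- Move over `c` input symbols. -/
def Prog.moves : ℕ → Prog R
  | 0 => .act id
  | c + 1 => .seq (.move .inp .back) (.moves c)

theorem does_moves (S : Mem R) (b : Bool) (q : List Γ') :
    ∀ (l p : List Γ'), Does (.moves l.length) b (seek S p (l ++ q)) b (seek S (p ++ l) q)
      (l.length + 1)
  | [], p => by
    simp only [List.length_nil, List.nil_append, List.append_nil]
    exact does_act id b (seek S p q)
  | y :: l, p => by
    have h := (does_move_seek S b p (l ++ q) y).seq (does_moves S b q l (p ++ [y]))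
    refine Does.mono ?_ (T := 1 + (l.length + 1)) (by simp; omega)
    simpa [Prog.moves] using h

/-- Execute `p`, which is to move forward in the input, as many times as the value of the variable
`i` says. -/
def Prog.advance (i : Fin R) (p : Prog R) : Prog R :=
  .seq (.forEach (.left i) .tmp p) (.moveAll .tmp (.left i))

theorem does_advance {S : Mem R} {i : Fin R} {n c : ℕ} (hi : S (.left i) = unary n)
    (ht : S .tmp = []) {prog : Prog R} {b : Bool} (p q : ℕ → List Γ')
    (hp : ∀ j < n, ∀ S : Mem R,
      Does prog b (seek S (p j) (q j)) b (seek S (p (j + 1)) (q (j + 1))) c) :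
    Does (.advance i prog) b (seek S (p 0) (q 0)) b (seek S (p n) (q n))
      (n * (c + 4) + 6) := by
  have h1 := does_forEach (w := .left i) (x := .tmp) (by simp) (p := prog) (b := b) (n := n)
    (c := c) (fun j => seek S (p j) (q j)) (by
      intro j l hjl
      simp only [seek_update (w := Work.left i) (by simp) (by simp),
        seek_update (w := Work.tmp) (by simp) (by simp)]
      exact hp j (by omega) _)
  have h2 := does_moveAll (w := .tmp) (x := .left i) (by simp) b (Function.update
    (Function.update (seek S (p n) (q n)) (.left i) []) .tmp (unary n))
  have e1 : Function.update (Function.update (seek S (p 0) (q 0)) (.left i) (unary n)) .tmp [] =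
      seek S (p 0) (q 0) := by
    rw [Function.update_eq_self_iff.2, Function.update_eq_self_iff.2]
    · exact hi.symm
    · simp [seek, ht]
  have e2 : Function.update (Function.update (Function.update
      (Function.update (seek S (p n) (q n)) (.left i) []) .tmp (unary n)) .tmp []) (.left i)
      (unary n) = seek S (p n) (q n) := by
    funext w
    simp only [Function.update_apply]
    split_ifs <;> simp_all [seek]
  rw [e1] at h1
  simp only [Function.update_self, reverse_unary, length_unary] at h2
  rw [Function.update_of_ne (by simp), Function.update_self, List.append_nil, e2] at h2
  exact (h1.seq h2).mono (by ring_nf; omega)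

section Rows

variable (I : RestrictedListInstance k)

open Classical in
/-- The row of the adjacency matrix that belongs to `v`. -/
noncomputable def rowBits (v : Fin I.n) : List Γ' :=
  (List.finRange I.n).map fun w => Γ'.bit (decide (I.graph.Adj v w))

open Classical in
/-- The characteristic vector of the list of `v`. -/
noncomputable def listBits (v : Fin I.n) : List Γ' :=
  (List.finRange k).map fun c => Γ'.bit (decide (c ∈ I.lists v))

theorem encodeVertex_eq (v : Fin I.n) : I.encodeVertex v =
    (rowBits I v ++ Γ'.comma :: listBits I v) ++ [Γ'.ket] := by
  simp [RestrictedListInstance.encodeVertex, rowBits, listBits]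

/-- The first `j` rows of the input. -/
noncomputable def before (j : ℕ) : List Γ' := ((List.finRange I.n).take j).flatMap I.encodeVertex

/-- The input without its first `j` rows. -/
noncomputable def after (j : ℕ) : List Γ' := ((List.finRange I.n).drop j).flatMap I.encodeVertex

theorem before_append_after (j : ℕ) : before I j ++ after I j = I.encode := by
  rw [before, after, ← List.flatMap_append, List.take_append_drop, RestrictedListInstance.encode]

theorem after_n : after I I.n = [] := by
  rw [after, List.drop_of_length_le (by simp)]; rfl

theorem before_succ (v : Fin I.n) : before I (v + 1) = before I v ++ I.encodeVertex v := by
  rw [before, before, List.take_add_one, List.flatMap_append]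
  simp

theorem after_eq (v : Fin I.n) : after I v = I.encodeVertex v ++ after I (v + 1) := by
  rw [after, after, List.drop_eq_getElem_cons (by simp)]
  simp

theorem length_before_le (j : ℕ) : (before I j).length ≤ I.encode.length := by
  rw [← before_append_after I j, List.length_append]
  omega

theorem n_le_length_encode : I.n ≤ I.encode.length := by
  rw [RestrictedListInstance.length_encode]
  exact Nat.le_mul_of_pos_right _ (by omega)

theorem row_le_length_encode (v : Fin I.n) : I.n + k + 2 ≤ I.encode.length := by
  rw [RestrictedListInstance.length_encode]
  exact Nat.le_mul_of_pos_left _ v.pos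

theorem does_skipRow (S : Mem R) (b : Bool) (v : Fin I.n) :
    Does (.skipTo Γ'.ket) b (seek S (before I v) (after I v)) b
      (seek S (before I (v + 1)) (after I (v + 1))) (2 * I.encode.length + 4) := by
  have h := does_skipTo S b (before I v) (after I (v + 1)) (y := Γ'.ket)
    (l := rowBits I v ++ Γ'.comma :: listBits I v) (by simp [rowBits, listBits])
  rw [before_succ, after_eq, encodeVertex_eq]
  have hlen := row_le_length_encode I v
  have e : rowBits I v ++ Γ'.comma :: listBits I v ++ [Γ'.ket] ++ after I (v + 1) =
      rowBits I v ++ Γ'.comma :: listBits I v ++ Γ'.ket :: after I (v + 1) := by simp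
  rw [e, ← List.append_assoc]
  exact h.mono (by simp [rowBits, listBits]; omega)

/-- Go to the row of the vertex that is the value of the variable `i`. -/
def Prog.gotoRow (i : Fin R) : Prog R := .advance i (.skipTo Γ'.ket)

theorem does_gotoRow {S : Mem R} {i : Fin R} (v : Fin I.n) (hi : S (.left i) = unary v)
    (ht : S .tmp = []) (b : Bool) :
    Does (.gotoRow i) b (seek S [] I.encode) b (seek S (before I v) (after I v))
      (I.encode.length * (2 * I.encode.length + 8) + 6) := by
  refine (does_advance hi ht (before I) (after I) fun j hj S =>
    does_skipRow I S b ⟨j, hj.trans v.2⟩).mono ?_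
  have := n_le_length_encode I
  gcongr
  omega

/-- The program that decides adjacency of the values of the variables `i` and `j`. -/
def Prog.adj (i j : Fin R) : Prog R :=
  .seq (.gotoRow i) (.seq (.advance j (.move .inp .back)) (.seq .readBit .rewind))

theorem does_readBit (S : Mem R) (b : Bool) :
    Does .readBit b S (decide ((S .inp).head? = some (Γ'.bit true))) S 1 :=
  fun _ => ⟨_, run_readBit _ _⟩

open Classical in
theorem does_adj {S : Mem R} {i j : Fin R} (v w : Fin I.n) (hi : S (.left i) = unary v)
    (hj : S (.left j) = unary w) (hinp : S .inp = I.encode) (hback : S .back = [])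
    (ht : S .tmp = []) (b : Bool) :
    Does (.adj i j) b S (decide (I.graph.Adj v w)) S
      (2 * I.encode.length * I.encode.length + 15 * I.encode.length + 17) := by
  have hlen : (rowBits I v).length = I.n := by simp [rowBits]
  have h1 := does_gotoRow I v hi ht b
  have hq : after I v =
      rowBits I v ++ (Γ'.comma :: listBits I v ++ [Γ'.ket] ++ after I (v + 1)) := by
    rw [after_eq, encodeVertex_eq]
    simp
  generalize Γ'.comma :: listBits I v ++ [Γ'.ket] ++ after I (v + 1) = rest at hq
  have h2 := does_advance (c := 1) hj ht (prog := .move .inp .back) (b := b)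
    (fun l => before I v ++ (rowBits I v).take l) (fun l => (rowBits I v).drop l ++ rest) (by
      intro l hl S
      have hl' : l < (rowBits I v).length := hlen ▸ hl.trans w.2
      rw [List.drop_eq_getElem_cons hl', List.take_add_one, List.getElem?_eq_getElem hl',
        Option.toList_some, ← List.append_assoc, List.cons_append]
      exact does_move_seek _ _ _ _ _)
  simp only [List.take_zero, List.drop_zero, List.append_nil, ← hq] at h2
  have h3 := does_readBit (seek S (before I v ++ (rowBits I v).take w)
    ((rowBits I v).drop w ++ rest)) b
  have h4 := does_rewind S (decide (I.graph.Adj v w)) (before I v ++ (rowBits I v).take w)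
    ((rowBits I v).drop w ++ rest)
  have hbit : ((rowBits I v).drop w ++ rest).head? = some (Γ'.bit (decide (I.graph.Adj v w))) := by
    rw [List.drop_eq_getElem_cons (by rw [hlen]; exact w.2)]
    simp [rowBits]
  have heq : before I v ++ (rowBits I v).take w ++ ((rowBits I v).drop w ++ rest) = I.encode := by
    rw [List.append_assoc, ← List.append_assoc ((rowBits I v).take w), List.take_append_drop, ← hq,
      before_append_after]
  simp only [seek_inp, hbit, Option.some.injEq, Γ'.bit.injEq, decide_eq_true_eq] at h3
  rw [heq, seek_nil hinp hback] at h4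
  rw [seek_nil hinp hback] at h1
  refine (h1.seq (h2.seq (h3.seq h4))).mono ?_
  have l1 := n_le_length_encode I
  have l2 := congrArg List.length heq
  rw [List.length_append] at l2
  have l3 : (w : ℕ) ≤ I.encode.length := by omega
  nlinarith

/-- The program that decides whether `c` is in the list of the value of the variable `i`. -/
def Prog.mem (c : ℕ) (i : Fin R) : Prog R :=
  .seq (.gotoRow i) (.seq (.skipTo Γ'.comma) (.seq (.moves c) (.seq .readBit .rewind)))

open Classical in
theorem does_mem {S : Mem R} {i : Fin R} (v : Fin I.n) (c : Fin k) (hi : S (.left i) = unary v)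
    (hinp : S .inp = I.encode) (hback : S .back = []) (ht : S .tmp = []) (b : Bool) :
    Does (.mem c i) b S (decide (c ∈ I.lists v)) S
      (2 * I.encode.length * I.encode.length + 15 * I.encode.length + 17) := by
  have hlen : (listBits I v).length = k := by simp [listBits]
  have h1 := does_gotoRow I v hi ht b
  set rest := Γ'.ket :: after I (v + 1)
  have hq : after I v = rowBits I v ++ Γ'.comma :: (listBits I v ++ rest) := by
    rw [after_eq, encodeVertex_eq]
    simp [rest]
  have h2 := does_skipTo S b (before I v) (listBits I v ++ rest) (y := Γ'.comma)
    (l := rowBits I v) (by simp [rowBits])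
  have h3 := does_moves S b ((listBits I v).drop c ++ rest) ((listBits I v).take c)
    (before I v ++ rowBits I v ++ [Γ'.comma])
  rw [← List.append_assoc ((listBits I v).take c), List.take_append_drop, List.length_take,
    min_eq_left (by omega)] at h3
  have h4 := does_readBit (seek S (before I v ++ rowBits I v ++ [Γ'.comma] ++
    (listBits I v).take c) ((listBits I v).drop c ++ rest)) b
  have h5 := does_rewind S (decide (c ∈ I.lists v)) (before I v ++ rowBits I v ++ [Γ'.comma] ++
    (listBits I v).take c) ((listBits I v).drop c ++ rest)
  have hbit : ((listBits I v).drop c ++ rest).head? = some (Γ'.bit (decide (c ∈ I.lists v))) := by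
    rw [List.drop_eq_getElem_cons (by rw [hlen]; exact c.2)]
    simp [listBits]
  have heq : before I v ++ rowBits I v ++ [Γ'.comma] ++ (listBits I v).take c ++
      ((listBits I v).drop c ++ rest) = I.encode := by
    rw [← before_append_after I v, hq, List.append_assoc _ ((listBits I v).take c),
      ← List.append_assoc ((listBits I v).take c), List.take_append_drop]
    simp
  simp only [seek_inp, hbit, Option.some.injEq, Γ'.bit.injEq, decide_eq_true_eq] at h4
  rw [heq, seek_nil hinp hback] at h5
  rw [seek_nil hinp hback, hq] at h1
  refine (h1.seq (h2.seq (h3.seq (h4.seq h5)))).mono ?_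
  have l1 := row_le_length_encode I v
  have l2 := congrArg List.length heq
  rw [List.length_append] at l2
  have l3 : (rowBits I v).length = I.n := by simp [rowBits]
  have l4 := c.2
  rw [l3]
  nlinarith

end Rows

end Evaluation

section Queries

variable {R k : ℕ}

/-! ### First-order queries -/

/-- The memory holds the input of the instance `I`, and the variables from `s` on are unused. -/
structure Ready (I : RestrictedListInstance k) (s : ℕ) (S : Mem R) : Prop where
  inp : S .inp = I.encode
  back : S .back = []
  tmp : S .tmp = []
  left : ∀ i : Fin R, s ≤ i → S (.left i) = []
  right : ∀ i : Fin R, s ≤ i → S (.right i) = unary I.n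

/-- A query with free variables `ι`: for each instance, a predicate of the vertices that are
assigned to the variables. -/
abbrev Query (k : ℕ) (ι : Type) := ∀ I : RestrictedListInstance k, (ι → Fin I.n) → Prop

open Classical in
/-- The program `p` evaluates the query `P` in time `T`, where the machine variable `e i` holds the
value of the query variable `i` and the machine variables from `s` on are free for use. -/
def Evaluates {ι : Type} (p : Prog R) (s : ℕ) (e : ι → Fin R) (P : Query k ι)
    (T : Polynomial ℕ) : Prop :=
  ∀ (I : RestrictedListInstance k) (ρ : ι → Fin I.n) (S : Mem R) (b : Bool), Ready I s S →
    (∀ i, S (.left (e i)) = unary (ρ i)) → Does p b S (decide (P I ρ)) S (T.eval I.encode.length)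

/-- The query can be evaluated in polynomial time by a program that uses a bounded number of
variables, `d`, in addition to those holding the input of the query. -/
def Evaluable {ι : Type} (P : Query k ι) : Prop :=
  ∃ d : ℕ, ∀ R s : ℕ, s + d ≤ R → ∀ e : ι → Fin R, (∀ i, (e i : ℕ) < s) →
    ∃ p T, Evaluates p s e P T

/-- Search for a value of the variable `i` that makes the truth value computed by `p` one. -/
def Prog.search (i : Fin R) (p : Prog R) : Prog R :=
  .seq (.act fun v => (v.1, false)) (.seq (.peek (.right i))
    (.seq (.loop (fun v => v.1.isSome && !v.2)
      (.seq p (.seq (.move (.right i) (.left i)) (.peek (.right i)))))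
      (.moveAll (.left i) (.right i))))

open Classical in
theorem does_search {S : Mem R} {i : Fin R} {n c : ℕ} {p : Prog R} {P : Fin n → Prop}
    (hl : S (.left i) = []) (hr : S (.right i) = unary n)
    (hp : ∀ (x : Fin n) (j : ℕ) (b : Bool), x + j = n →
      Does p b (Function.update (Function.update S (.left i) (unary x)) (.right i) (unary j))
        (decide (P x))
        (Function.update (Function.update S (.left i) (unary x)) (.right i) (unary j)) c)
    (b : Bool) :
    Does (.search i p) b S (decide (∃ x, P x)) S (n * (c + 5) + 10) := by
  -- `G x j` is the memory when the variable has the value `x` and `j` values are left.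
  let G : ℕ → ℕ → Mem R := fun x j =>
    Function.update (Function.update S (.left i) (unary x)) (.right i) (unary j)
  have hpeek : ∀ (x j : ℕ) (v : Reg),
      Run (.peek (.right i)) (v, G x j) (((unary j).head?, v.2), G x j) 1 := fun x j v => by
    simpa [G] using run_peek (.right i) v (G x j)
  have hmove : ∀ (x j : ℕ) (v : Reg),
      Run (.move (.right i) (.left i)) (v, G x (j + 1)) ((some Γ'.blank, v.2), G (x + 1) j) 1 := by
    intro x j v
    have h := run_move_cons (w := .right i) (x := .left i) (by simp) v (S := G x (j + 1))
      (y := Γ'.blank) (l := unary j) (by simp [G, unary_succ])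
    convert h using 2
    funext w
    simp only [G, Function.update_apply]
    split_ifs <;> simp_all [unary_succ]
  have key : ∀ j x, x + j = n → (∀ y : Fin n, (y : ℕ) < x → ¬ P y) → ∃ x' j' z, x' + j' = n ∧
      Run (.loop (fun v => v.1.isSome && !v.2)
        (.seq p (.seq (.move (.right i) (.left i)) (.peek (.right i)))))
        (((unary j).head?, false), G x j) ((z, decide (∃ x, P x)), G x' j') (j * (c + 3) + 1) := by
    intro j
    induction j with
    | zero =>
      intro x hx hn
      have : ¬ ∃ x, P x := fun ⟨y, hy⟩ => hn y (by omega) hy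
      refine ⟨x, 0, (unary 0).head?, hx, ?_⟩
      rw [decide_eq_false this]
      exact (run_loop_false rfl).mono (by omega)
    | succ j ih =>
      intro x hx hn
      have hxn : x < n := by omega
      obtain ⟨z, hz⟩ := hp ⟨x, hxn⟩ (j + 1) false hx (unary (j + 1)).head?
      have hbody := hz.seq ((hmove x j _).seq (hpeek (x + 1) j _))
      by_cases hP : P ⟨x, hxn⟩
      · refine ⟨x + 1, j, (unary j).head?, by omega, ?_⟩
        have : ∃ x, P x := ⟨_, hP⟩
        rw [decide_eq_true hP] at hbody
        rw [decide_eq_true this]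
        exact (run_loop_true rfl hbody (run_loop_false (by simp))).mono (by ring_nf; omega)
      · obtain ⟨x', j', z', hx', h'⟩ := ih (x + 1) (by omega) (fun y hy hPy => by
          rcases Nat.lt_succ_iff_lt_or_eq.1 hy with h | h
          · exact hn y h hPy
          · exact hP (by convert hPy; exact h.symm))
        refine ⟨x', j', z', hx', ?_⟩
        rw [decide_eq_false hP] at hbody
        exact (run_loop_true rfl hbody h').mono (by ring_nf; omega)
  have hS : G 0 n = S := by
    simp only [G, unary_zero, ← hl, ← hr, Function.update_eq_self]
  intro x
  obtain ⟨x', j', z, hxj, hloop⟩ := key n 0 (by omega) (by omega)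
  have h1 := hpeek 0 n (x, false)
  rw [hS] at h1 hloop
  obtain ⟨z', h2⟩ := does_moveAll (w := .left i) (x := .right i) (by simp)
    (decide (∃ x, P x)) (G x' j') z
  have h3 : Function.update (Function.update (G x' j') (.left i) []) (.right i)
      ((G x' j' (.left i)).reverse ++ G x' j' (.right i)) = S := by
    have e1 : G x' j' (.left i) = unary x' := by simp [G]
    have e2 : G x' j' (.right i) = unary j' := by simp [G]
    rw [e1, e2, reverse_unary, unary_append, hxj, ← hr, ← hl]
    funext w
    simp only [G, Function.update_apply]
    split_ifs <;> simp_all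
  have h4 : (G x' j' (.left i)).length = x' := by simp [G]
  rw [h3, h4] at h2
  exact ⟨z', ((run_act _ _ _).seq (h1.seq (hloop.seq h2))).mono (by ring_nf; omega)⟩

namespace Evaluable

variable {ι κ : Type}

theorem congr {P Q : Query k ι} (h : Evaluable P) (e : ∀ I ρ, Q I ρ ↔ P I ρ) : Evaluable Q := by
  obtain rfl : Q = P := by
    funext I ρ
    exact propext (e I ρ)
  exact h

theorem subst {P : Query k ι} (h : Evaluable P) (f : ι → κ) :
    Evaluable fun I ρ => P I fun i => ρ (f i) := by
  obtain ⟨d, h⟩ := h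
  refine ⟨d, fun R s hR e he => ?_⟩
  obtain ⟨p, T, hp⟩ := h R s hR (fun i => e (f i)) fun i => he _
  exact ⟨p, T, fun I ρ S b hS hρ => hp I _ S b hS fun i => hρ _⟩

theorem true : Evaluable fun (_ : RestrictedListInstance k) (_ : ι → _) => True := by
  refine ⟨0, fun R s _ e _ => ⟨.act fun v => (v.1, Bool.true), 1, fun I ρ S b _ _ => ?_⟩⟩
  simpa using does_act (fun _ => Bool.true) b S

theorem adj (i j : ι) :
    Evaluable fun (I : RestrictedListInstance k) ρ => I.graph.Adj (ρ i) (ρ j) := by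
  refine ⟨0, fun R s _ e _ => ⟨.adj (e i) (e j), 2 * .X * .X + 15 * .X + 17,
    fun I ρ S b hS hρ => ?_⟩⟩
  simpa using does_adj I (ρ i) (ρ j) (hρ i) (hρ j) hS.inp hS.back hS.tmp b

theorem mem (c : Fin k) (i : ι) :
    Evaluable fun (I : RestrictedListInstance k) ρ => c ∈ I.lists (ρ i) := by
  refine ⟨0, fun R s _ e _ => ⟨.mem c (e i), 2 * .X * .X + 15 * .X + 17,
    fun I ρ S b hS hρ => ?_⟩⟩
  simp only [Polynomial.eval_add, Polynomial.eval_mul, Polynomial.eval_X, Polynomial.eval_ofNat]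
  convert does_mem I (ρ i) c (hρ i) hS.inp hS.back hS.tmp b

open Classical in
theorem not {P : Query k ι} (h : Evaluable P) : Evaluable fun I ρ => ¬ P I ρ := by
  obtain ⟨d, h⟩ := h
  refine ⟨d, fun R s hR e he => ?_⟩
  obtain ⟨p, T, hp⟩ := h R s hR e he
  refine ⟨.seq p (.act fun v => (v.1, !v.2)), T + 1, fun I ρ S b hS hρ => ?_⟩
  have h := (hp I ρ S b hS hρ).seq (does_act (fun b => !b) _ S)
  rw [← decide_not] at h
  simp only [Polynomial.eval_add, Polynomial.eval_one]
  convert h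

open Classical in
theorem and {P Q : Query k ι} (hP : Evaluable P) (hQ : Evaluable Q) :
    Evaluable fun I ρ => P I ρ ∧ Q I ρ := by
  obtain ⟨d, hP⟩ := hP
  obtain ⟨d', hQ⟩ := hQ
  refine ⟨max d d', fun R s hR e he => ?_⟩
  obtain ⟨p, T, hp⟩ := hP R s (by omega) e he
  obtain ⟨q, T', hq⟩ := hQ R s (by omega) e he
  refine ⟨.seq p (.cond (fun v => v.2) q), T + (1 + T'), fun I ρ S b hS hρ => ?_⟩
  have h := (hp I ρ S b hS hρ).and (hq I ρ S _ hS hρ)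
  simp only [Polynomial.eval_add, Polynomial.eval_one]
  convert h

/-- The bound variable is the first unused variable of the machine, so that the variables in use
are not overwritten. -/
theorem ex {A : ∀ I : RestrictedListInstance k, (ι → Fin I.n) → Fin I.n → Prop}
    (h : Evaluable fun I (τ : Option ι → Fin I.n) => A I (fun i => τ (some i)) (τ none)) :
    Evaluable fun I ρ => ∃ v, A I ρ v := by
  obtain ⟨d, h⟩ := h
  refine ⟨d + 1, fun R s hR e he => ?_⟩
  let i₀ : Fin R := ⟨s, by omega⟩
  obtain ⟨p, T, hp⟩ := h R (s + 1) (by omega) (fun o => o.elim i₀ e) (by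
    rintro (_ | i)
    · exact Nat.lt_succ_self s
    · exact (he i).trans (Nat.lt_succ_self s))
  refine ⟨.search i₀ p, .X * (T + 5) + 10, fun I ρ S b hS hρ => ?_⟩
  have h := (does_search (P := A I ρ) (c := T.eval I.encode.length) (hS.left i₀ le_rfl)
    (hS.right i₀ le_rfl) (p := p) (fun x j b _ => ?_) b).mono
      (T' := (Polynomial.X * (T + 5) + 10).eval I.encode.length) ?_
  · convert h
  · refine hp I (fun o => o.elim x ρ) _ b ⟨?_, ?_, ?_, fun i hi => ?_, fun i hi => ?_⟩ ?_
    · simpa using hS.inp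
    · simpa using hS.back
    · simpa using hS.tmp
    · have : i ≠ i₀ := fun h => by subst h; exact absurd hi (by simp [i₀])
      simpa [this] using hS.left i (by omega)
    · have : i ≠ i₀ := fun h => by subst h; exact absurd hi (by simp [i₀])
      simpa [this] using hS.right i (by omega)
    · rintro (_ | i)
      · simp
      · have : e i ≠ i₀ := fun h => absurd (he i) (by simp [h, i₀])
        simpa [this] using hρ i
  · have := n_le_length_encode I
    simp
    gcongr

theorem all {A : ∀ I : RestrictedListInstance k, (ι → Fin I.n) → Fin I.n → Prop}
    (h : Evaluable fun I (τ : Option ι → Fin I.n) => A I (fun i => τ (some i)) (τ none)) :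
    Evaluable fun I ρ => ∀ v, A I ρ v :=
  (ex (A := fun I ρ v => ¬ A I ρ v) h.not).not.congr fun I ρ => by simp

theorem or {P Q : Query k ι} (hP : Evaluable P) (hQ : Evaluable Q) :
    Evaluable fun I ρ => P I ρ ∨ Q I ρ :=
  (hP.not.and hQ.not).not.congr fun I ρ => by tauto

theorem imp {P Q : Query k ι} (hP : Evaluable P) (hQ : Evaluable Q) :
    Evaluable fun I ρ => P I ρ → Q I ρ :=
  (hP.and hQ.not).not.congr fun I ρ => by tauto

/-- The truth value must not depend on the instance. -/
theorem const (p : Prop) : Evaluable fun (_ : RestrictedListInstance k) (_ : ι → _) => p := by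
  by_cases hp : p
  · exact true.congr fun _ _ => by simp [hp]
  · exact true.not.congr fun _ _ => by simp [hp]

/-- Finite conjunctions, over an index type that does not depend on the instance. -/
theorem finAll {J : Type} [Finite J] {P : J → Query k ι} (h : ∀ j, Evaluable (P j)) :
    Evaluable fun I ρ => ∀ j, P j I ρ := by
  have key : ∀ l : List J, Evaluable fun I ρ => ∀ j ∈ l, P j I ρ := by
    intro l
    induction l with
    | nil => exact true.congr fun _ _ => by simp
    | cons j l ih => exact ((h j).and ih).congr fun _ _ => by simp
  have := Fintype.ofFinite J
  exact (key Finset.univ.toList).congr fun _ _ => by simp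

theorem finEx {J : Type} [Finite J] {P : J → Query k ι} (h : ∀ j, Evaluable (P j)) :
    Evaluable fun I ρ => ∃ j, P j I ρ :=
  (finAll fun j => (h j).not).not.congr fun I ρ => by simp

/-- Quantification over finite families of vertices. -/
theorem exFamily {J : Type} [Finite J]
    {A : ∀ I : RestrictedListInstance k, (ι → Fin I.n) → (J → Fin I.n) → Prop}
    (h : Evaluable fun I (τ : ι ⊕ J → Fin I.n) => A I (fun i => τ (.inl i)) fun j => τ (.inr j)) :
    Evaluable fun I ρ => ∃ u, A I ρ u := by
  have key : ∀ (J : Type) [Finite J] (ι : Type)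
      (A : ∀ I : RestrictedListInstance k, (ι → Fin I.n) → (J → Fin I.n) → Prop),
      (Evaluable fun I (τ : ι ⊕ J → Fin I.n) => A I (fun i => τ (.inl i)) fun j => τ (.inr j)) →
      Evaluable fun I ρ => ∃ u, A I ρ u := by
    intro J _
    induction J using Finite.induction_empty_option with
    | of_equiv e ih =>
      intro ι A h
      refine (ih ι (fun I ρ u => A I ρ fun j => u (e.symm j))
        (h.subst (Sum.map id e.symm))).congr fun I ρ => ?_
      exact ⟨fun ⟨u, hu⟩ => ⟨fun j => u (e j), by simpa using hu⟩, fun ⟨u, hu⟩ => ⟨_, hu⟩⟩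
    | h_empty =>
      intro ι A h
      refine (h.subst (fun x : ι ⊕ PEmpty => x.elim id PEmpty.elim)).congr fun I ρ => ?_
      refine ⟨fun ⟨u, hu⟩ => ?_, fun hu => ⟨_, hu⟩⟩
      rwa [Subsingleton.elim u fun j => ρ (Sum.elim id PEmpty.elim (Sum.inr j))] at hu
    | h_option ih =>
      rename_i α _
      intro ι A h
      refine (ex (A := fun I ρ v => ∃ u : α → Fin I.n, A I ρ fun o => o.elim v u)
        (ih (Option ι) (fun I τ u => A I (fun i => τ (some i)) fun o => o.elim (τ none) u)
          ?_)).congr fun I ρ => ?_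
      · refine (h.subst (fun x : ι ⊕ Option α => x.elim (fun i => Sum.inl (some i))
          fun o => o.elim (Sum.inl none) Sum.inr)).congr fun I τ => ?_
        apply iff_of_eq
        congr 1
        funext o
        cases o <;> rfl
      · constructor
        · rintro ⟨u, hu⟩
          refine ⟨u none, fun a => u (some a), ?_⟩
          convert hu using 1
          funext o
          cases o <;> rfl
        · rintro ⟨v, u, hu⟩
          exact ⟨_, hu⟩
  exact key J ι A h

/-- Substitution in a query whose last variable is singled out. -/
theorem apply {A : ∀ I : RestrictedListInstance k, (ι → Fin I.n) → Fin I.n → Prop}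
    (h : Evaluable fun I (τ : Option ι → Fin I.n) => A I (fun i => τ (some i)) (τ none))
    (f : ι → κ) (j : κ) : Evaluable fun I ρ => A I (fun i => ρ (f i)) (ρ j) :=
  h.subst fun o : Option ι => o.elim j f

theorem near {A : ∀ I : RestrictedListInstance k, (ι → Fin I.n) → Fin I.n → Prop}
    (h : Evaluable fun I (τ : Option ι → Fin I.n) => A I (fun i => τ (some i)) (τ none))
    (r : ι) : ∀ t, Evaluable fun I (τ : Option ι → Fin I.n) =>
      Near I.graph (A I fun i => τ (some i)) (τ (some r)) t (τ none)
  | 0 => h.and (adj (some r) none)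
  | t + 1 => by
    refine h.and (ex (A := fun I τ z => Near I.graph (A I fun i => τ (some i)) (τ (some r)) t z ∧
      I.graph.Adj z (τ none)) (and ?_ (adj _ _)))
    exact apply (A := fun I ρ v => Near I.graph (A I ρ) (ρ r) t v) (near h r t)
      (fun i => some (some i)) none

theorem inComp {A : ∀ I : RestrictedListInstance k, (ι → Fin I.n) → Fin I.n → Prop}
    (h : Evaluable fun I (τ : Option ι → Fin I.n) => A I (fun i => τ (some i)) (τ none))
    (r : ι) : Evaluable fun I (τ : Option ι → Fin I.n) =>
      InComp I.graph (A I fun i => τ (some i)) (τ (some r)) (τ none) :=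
  (near h r 0).or ((near h r 1).or (near h r 2))

theorem residual {L : Fin k → ∀ I : RestrictedListInstance k, (ι → Fin I.n) → Fin I.n → Prop}
    (h : ∀ c, Evaluable fun I (τ : Option ι → Fin I.n) => L c I (fun i => τ (some i)) (τ none))
    (u : GuessIndex (Fin k) → ι) (g : GuessIndex (Fin k) → Fin k) (c : Fin k) :
    Evaluable fun I (τ : Option ι → Fin I.n) =>
      Residual I.graph (fun c => L c I fun i => τ (some i)) (fun j => τ (some (u j))) g c
        (τ none) :=
  (h c).and (finAll fun j => (const (g j = c)).imp (adj none (some (u j))).not)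

theorem pruned {B : ∀ I : RestrictedListInstance k, (ι → Fin I.n) → Fin I.n → Prop}
    (hB : Evaluable fun I (τ : Option ι → Fin I.n) => B I (fun i => τ (some i)) (τ none))
    {L : Fin k → ∀ I : RestrictedListInstance k, (ι → Fin I.n) → Fin I.n → Prop}
    (h : ∀ c, Evaluable fun I (τ : Option ι → Fin I.n) => L c I (fun i => τ (some i)) (τ none))
    (u : GuessIndex (Fin k) → ι) (g : GuessIndex (Fin k) → Fin k) (c : Fin k) :
    Evaluable fun I (τ : Option ι → Fin I.n) =>
      Pruned I.graph (B I fun i => τ (some i)) (fun c => L c I fun i => τ (some i))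
        (fun j => τ (some (u j))) g c (τ none) := by
  refine (residual h u g c).and (not (ex (A := fun I τ y => B I (fun i => τ (some i)) y ∧
    I.graph.Adj (τ none) y ∧ Residual I.graph (fun c => L c I fun i => τ (some i))
        (fun j => τ (some (u j))) g c y ∧ ∃ i, I.graph.Adj (τ none) (τ (some (u (.inl i)))) ∧
        ¬ I.graph.Adj y (τ (some (u (.inl i)))))
    (and ?_ (and (adj _ _) (and ?_ (finEx fun i => and (adj _ _) (not (adj _ _))))))))
  · exact apply hB (fun i => some (some i)) none
  · exact apply (A := fun I ρ v => Residual I.graph (fun c => L c I ρ) (fun j => ρ (u j)) g c v)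
      (residual h u g c) (fun i => some (some i)) none

/-- The colouring algorithm is a first-order query: its number of rounds does not depend on the
graph, and in each round boundedly many vertices are guessed. -/
theorem solvable : ∀ (m : ℕ) {ι : Type}
    {A : ∀ I : RestrictedListInstance k, (ι → Fin I.n) → Fin I.n → Prop}
    (_ : Evaluable fun I (τ : Option ι → Fin I.n) => A I (fun i => τ (some i)) (τ none))
    {L : Fin k → ∀ I : RestrictedListInstance k, (ι → Fin I.n) → Fin I.n → Prop}
    (_ : ∀ c, Evaluable fun I (τ : Option ι → Fin I.n) => L c I (fun i => τ (some i)) (τ none)),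
    Evaluable fun I ρ => Solvable I.graph m (A I ρ) fun c => L c I ρ
  | 0, _, A, hA, _, _ => all (A := fun I ρ v => ¬ A I ρ v) hA.not
  | m + 1, ι, A, hA, L, hL => by
    let J := GuessIndex (Fin k)
    have hA' := apply hA (κ := Option (Option ι ⊕ J)) (fun i => some (.inl (some i))) none
    have hL' := fun c => apply (hL c) (κ := Option (Option ι ⊕ J))
      (fun i => some (.inl (some i))) none
    have hB := inComp (ι := Option ι ⊕ J) (A := fun I τ v => A I (fun i => τ (.inl (some i))) v)
      hA' (.inl none)
    refine all (A := fun I ρ r => A I ρ r → (∃ c, L c I ρ r) ∧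
      ∃ u : J → Fin I.n, ∃ g : J → Fin k,
        (∀ v, InComp I.graph (A I ρ) r v → ∃ i, I.graph.Adj v (u (.inl i))) ∧
        ∀ i, Solvable I.graph m (fun v => InComp I.graph (A I ρ) r v ∧ I.graph.Adj v (u (.inl i)))
          (Pruned I.graph (InComp I.graph (A I ρ) r) (fun c => L c I ρ) u g))
      (imp hA (and (finEx hL) (exFamily (A := fun I τ u => ∃ g : J → Fin k,
        (∀ v, InComp I.graph (A I fun i => τ (some i)) (τ none) v →
          ∃ i, I.graph.Adj v (u (.inl i))) ∧
        ∀ i, Solvable I.graph m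
          (fun v => InComp I.graph (A I fun i => τ (some i)) (τ none) v ∧
            I.graph.Adj v (u (.inl i)))
          (Pruned I.graph (InComp I.graph (A I fun i => τ (some i)) (τ none))
            (fun c => L c I fun i => τ (some i)) u g))
        (finEx fun g => and ?_ (finAll fun i => ?_)))))
    · exact all (A := fun I (τ : Option ι ⊕ J → Fin I.n) v =>
        InComp I.graph (A I fun i => τ (.inl (some i))) (τ (.inl none)) v →
          ∃ i, I.graph.Adj v (τ (.inr (.inl i)))) (imp hB (finEx fun i => adj _ _))
    · exact solvable m (ι := Option ι ⊕ J)
        (A := fun I τ v => InComp I.graph (A I fun i => τ (.inl (some i))) (τ (.inl none)) v ∧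
          I.graph.Adj v (τ (.inr (.inl i))))
        (L := fun c I τ v => Pruned I.graph
          (InComp I.graph (A I fun i => τ (.inl (some i))) (τ (.inl none)))
          (fun c => L c I fun i => τ (.inl (some i))) (fun j => τ (.inr j)) g c v)
        (and hB (adj _ _))
        (fun c => pruned (ι := Option ι ⊕ J) (B := fun I τ v =>
          InComp I.graph (A I fun i => τ (.inl (some i))) (τ (.inl none)) v) hB
          (L := fun c I τ v => L c I (fun i => τ (.inl (some i))) v) hL' Sum.inr g c)

end Evaluable

end Queries

section Assembly

variable {R k : ℕ}

/-! ### The machine -/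

/-- The memory with the whole input unread and with the counters of the variables in `l` set up. -/
noncomputable def setup (I : RestrictedListInstance k) (l : List (Fin R)) : Mem R
  | .inp => I.encode
  | .back => []
  | .tmp => []
  | .left _ => []
  | .right i => if i ∈ l then unary I.n else []

theorem setup_cons (I : RestrictedListInstance k) (i : Fin R) (l : List (Fin R)) :
    Function.update (setup I l) (.right i) (unary I.n) = setup I (i :: l) := by
  funext w
  cases w with
  | right j => by_cases h : j = i <;> simp [setup, h]
  | _ => simp [setup]

/-- Set up the counter of the variable `i`, by counting the rows of the input. -/
def Prog.initVar (i : Fin R) : Prog R :=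
  .seq (.peek .inp) (.seq (.loop (fun v => v.1.isSome)
    (.seq (.skipTo Γ'.ket) (.seq (.push (.right i)) (.peek .inp)))) .rewind)

theorem does_initVar (I : RestrictedListInstance k) {i : Fin R} {l : List (Fin R)} (hi : i ∉ l)
    (b : Bool) : Does (.initVar i) b (setup I l) b (setup I (i :: l))
      (I.encode.length * (2 * I.encode.length + 7) + 2 * I.encode.length + 6) := by
  -- `G x` is the memory when `x` rows have been counted.
  let G : ℕ → Mem R := fun x =>
    seek (Function.update (setup I l) (.right i) (unary x)) (before I x) (after I x)
  have hpeek : ∀ (x : ℕ) (v : Reg),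
      Run (.peek .inp) (v, G x) (((after I x).head?, v.2), G x) 1 := fun x v =>
    run_peek .inp v (G x)
  have hpush : ∀ (x : ℕ) (v : Reg), Run (.push (.right i))
      (v, seek (Function.update (setup I l) (.right i) (unary x)) (before I (x + 1))
        (after I (x + 1))) (v, G (x + 1)) 1 := by
    intro x v
    have h := run_push (.right i) v (seek (Function.update (setup I l) (.right i) (unary x))
      (before I (x + 1)) (after I (x + 1)))
    rw [seek_update (by simp) (by simp), Function.update_idem] at h
    convert h using 4
    simp [seek, unary_succ]
  have key : ∀ j x, x + j = I.n → Run (.loop (fun v => v.1.isSome)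
      (.seq (.skipTo Γ'.ket) (.seq (.push (.right i)) (.peek .inp))))
      (((after I x).head?, b), G x) ((none, b), G I.n) (j * (2 * I.encode.length + 7) + 1) := by
    intro j
    induction j with
    | zero =>
      intro x hx
      obtain rfl : x = I.n := by omega
      rw [after_n]
      exact (run_loop_false rfl).mono (by omega)
    | succ j ih =>
      intro x hx
      have hxn : x < I.n := by omega
      have hhead : (after I x).head?.isSome = true := by
        rw [show x = (⟨x, hxn⟩ : Fin I.n) from rfl, after_eq, encodeVertex_eq]
        simp
      obtain ⟨z, hz⟩ := does_skipRow I (Function.update (setup I l) (.right i) (unary x)) b ⟨x, hxn⟩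
        (after I x).head?
      exact (run_loop_true hhead (hz.seq ((hpush x _).seq (hpeek _ _))) (ih (x + 1) (by omega))).mono
        (by ring_nf; omega)
  intro x
  have h0 : G 0 = setup I l := by
    have : Function.update (setup I l) (.right i) (unary 0) = setup I l := by
      rw [unary_zero, Function.update_eq_self_iff]
      simp [setup, hi]
    simp only [G, this]
    exact seek_nil rfl rfl
  have h1 := hpeek 0 (x, b)
  have h2 := key I.n 0 (by omega)
  obtain ⟨z, h3⟩ := does_rewind (Function.update (setup I l) (.right i) (unary I.n)) b
    (before I I.n) (after I I.n) none
  rw [before_append_after, setup_cons,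
    seek_nil (S := setup I (i :: l)) (q := I.encode) rfl rfl] at h3
  rw [h0] at h1 h2
  have e : G I.n = seek (setup I (i :: l)) (before I I.n) (after I I.n) := by
    simp only [G, setup_cons]
  rw [e] at h2
  refine ⟨z, (h1.seq (h2.seq h3)).mono ?_⟩
  have e1 := n_le_length_encode I
  have e2 := length_before_le I I.n
  have e3 : I.n * (2 * I.encode.length + 7) ≤ I.encode.length * (2 * I.encode.length + 7) := by
    gcongr
  omega

/-- Set up the counters of the variables in a list. -/
def Prog.init : List (Fin R) → Prog R
  | [] => .act id
  | i :: l => .seq (.init l) (.initVar i)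

theorem exists_does_init : ∀ {l : List (Fin R)}, l.Nodup → ∃ T : Polynomial ℕ,
    ∀ (I : RestrictedListInstance k) (b : Bool),
      Does (.init l) b (setup I []) b (setup I l) (T.eval I.encode.length)
  | [], _ => ⟨1, fun I b => (does_act id b (setup (R := R) I [])).mono (by simp)⟩
  | i :: l, hl => by
    obtain ⟨T, hT⟩ := exists_does_init (List.nodup_cons.1 hl).2
    refine ⟨T + (.X * (2 * .X + 7) + 2 * .X + 6), fun I b => ?_⟩
    exact ((hT I b).seq (does_initVar I (List.nodup_cons.1 hl).1 b)).mono (by simp)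

/-- Empty the counters of the variables in a list. -/
def Prog.clearVars : List (Fin R) → Prog R
  | [] => .act id
  | i :: l => .seq (.clear (.right i)) (.clearVars l)

theorem exists_does_clearVars : ∀ {l : List (Fin R)}, l.Nodup → ∃ T : Polynomial ℕ,
    ∀ (I : RestrictedListInstance k) (b : Bool),
      Does (.clearVars l) b (setup I l) b (setup I []) (T.eval I.encode.length)
  | [], _ => ⟨1, fun I b => (does_act id b (setup (R := R) I [])).mono (by simp)⟩
  | i :: l, hl => by
    obtain ⟨T, hT⟩ := exists_does_clearVars (List.nodup_cons.1 hl).2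
    refine ⟨2 * .X + 4 + T, fun I b => ?_⟩
    have h := does_clear (.right i) b (setup I (i :: l))
    have e : Function.update (setup I (i :: l)) (.right i) [] = setup I l := by
      rw [← setup_cons, Function.update_idem, Function.update_eq_self_iff]
      simp [setup, (List.nodup_cons.1 hl).1]
    rw [e] at h
    have h' : (setup I (i :: l) (.right i)).length ≤ I.encode.length := by
      simpa [setup] using n_le_length_encode I
    exact ((h.mono (T' := 2 * I.encode.length + 4) (by omega)).seq (hT I b)).mono (by simp)

/-- The machine that executes `p` and then outputs the truth value. -/
def Prog.machine (p : Prog R) : FinTM2 :=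
  letI := p.fin
  { K := Stack R
    k₀ := some .inp
    k₁ := none
    Γ := Alphabet R
    Λ := Option p.Lab
    main := some p.entry
    σ := Reg
    initialState := (none, false)
    Γk₀Fin := inferInstanceAs (Fintype Γ')
    m := fun
      | some l => p.code some none l
      | none => .push none (fun v => v.2) (.load (fun _ => (none, false)) .halt) }

/-- The stacks are empty at the end, and the last step writes the output and resets the state. -/
theorem outputs_machine {p : Prog R} {x : Option Γ'} {b : Bool} {S S' : Mem R} {T : ℕ}
    (h : Run p ((none, false), S) ((x, b), S') T) (hS : ∀ w ≠ .inp, S w = [])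
    (hS' : ∀ w, S' w = []) :
    Nonempty (TM2OutputsInTime p.machine (S .inp) (some [b]) (T + 1)) := by
  refine evalsToInTime_trans (b := ⟨some none, (x, b), S'.full⟩) ?_ (evalsToInTime_step ?_)
  · have h1 := h p.machine.m some none fun _ => rfl
    have e : initList p.machine (S .inp) =
        (⟨some (some p.entry), (none, false), S.full⟩ : TM2.Cfg (Alphabet R) (Option p.Lab) Reg) := by
      refine congrArg (TM2.Cfg.mk _ _) ?_
      funext w
      rcases w with _ | w
      · rfl
      · by_cases hw : w = .inp
        · subst hw
          rfl
        · refine (dif_neg fun e => hw (Option.some.inj e)).trans (hS w hw).symm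
    rw [e]
    exact h1
  · refine congrArg some (congrArg (TM2.Cfg.mk _ _) ?_)
    funext w
    rcases w with _ | w
    · exact Function.update_self ..
    · exact (Function.update_of_ne (Option.some_ne_none w) ..).trans (hS' w)

/-- Queries without free variables that have polynomial-time programs are decided by
machines in polynomial time, on any class of instances. -/
theorem Evaluable.decidableInPolyTime {P : Query k Empty} (h : Evaluable P)
    (K : RestrictedListInstance k → Prop) :
    DecidableInPolyTime (fun I : {I // K I} => I.1.encode) fun I => P I.1 Empty.elim := by
  obtain ⟨R, h⟩ := h
  obtain ⟨p, T, hp⟩ := h R 0 (by omega) Empty.elim fun i => i.elim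
  obtain ⟨T₁, h₁⟩ := exists_does_init (k := k) (List.nodup_finRange R)
  obtain ⟨T₂, h₂⟩ := exists_does_clearVars (k := k) (List.nodup_finRange R)
  let q : Prog R := .seq (.init (List.finRange R)) (.seq p
    (.seq (.clearVars (List.finRange R)) (.clear .inp)))
  classical
  have hq : ∀ I : RestrictedListInstance k,
      Nonempty (TM2OutputsInTime q.machine I.encode (some [decide (P I Empty.elim)])
        ((T₁ + (T + (T₂ + (2 * .X + 4))) + 1 : Polynomial ℕ).eval I.encode.length)) := by
    intro I
    have hready : Ready I 0 (setup I (List.finRange R)) :=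
      ⟨rfl, rfl, rfl, fun _ _ => rfl, fun i _ => by simp [setup]⟩
    obtain ⟨x, hx⟩ := ((h₁ I false).seq ((hp I Empty.elim _ false hready fun i => i.elim).seq
      ((h₂ I _).seq (does_clear .inp _ _)))) none
    have := outputs_machine (p := q) hx (fun w hw => by cases w <;> simp_all [setup])
      (fun w => by cases w <;> simp [setup])
    simp only [Polynomial.eval_add, Polynomial.eval_mul, Polynomial.eval_X, Polynomial.eval_ofNat,
      Polynomial.eval_one]
    exact this
  exact ⟨{
    tm := q.machine
    inputAlphabet := Equiv.refl Γ'
    outputAlphabet := Equiv.refl Bool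
    time := T₁ + (T + (T₂ + (2 * .X + 4))) + 1
    outputsFun := fun I => by
      have h : ∀ l : List Γ', l = I.1.encode →
          TM2OutputsInTime q.machine l (some [decide (P I.1 Empty.elim)])
            ((T₁ + (T + (T₂ + (2 * .X + 4))) + 1 : Polynomial ℕ).eval I.1.encode.length) :=
        fun l hl => hl ▸ (hq I.1).some
      exact h _ (List.map_id _) }⟩

/-- `k` rounds decide colourability, since at most `k` colours occur in the lists. -/
theorem solvable_iff (I : RestrictedListInstance k) (hI : I.graph.IsP5Free) :
    Solvable I.graph k (fun _ => True) (fun c v => c ∈ I.lists v) ↔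
      I.graph.IsListColourable I.lists := by
  have hiff : ColourableOn I.graph (fun _ => True) (fun c v => c ∈ I.lists v) ↔
      I.graph.IsListColourable I.lists :=
    ⟨fun ⟨f, hf, hf'⟩ => ⟨SimpleGraph.Coloring.mk f fun h => hf' _ _ trivial trivial h,
      fun v => hf v trivial⟩,
      fun ⟨f, hf⟩ => ⟨f, fun v _ => hf v, fun _ _ _ _ h => f.valid h⟩⟩
  constructor
  · intro h
    rcases k with _ | k
    · -- Without colours there are no functions to the colours unless there are no vertices.
      have hV : IsEmpty (Fin I.n) := ⟨fun v => h v trivial⟩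
      exact ⟨SimpleGraph.Coloring.mk (fun v => hV.elim v) fun {v} => hV.elim v, fun v => hV.elim v⟩
    · exact hiff.1 (h.colourableOn hI)
  · intro h
    refine (hiff.2 h).solvable hI ?_
    exact (Set.ncard_le_card _).trans (by simp)

end Assembly
end P5FreeColouring

theorem mainTheorem1 (k : ℕ) :
    DecidableInPolyTime
      (fun I : {I : RestrictedListInstance k // I.graph.IsP5Free} => I.1.encode)
      (fun I => I.1.graph.IsListColourable I.1.lists) := by
  have h := (P5FreeColouring.Evaluable.solvable (k := k) (ι := Empty) k
    (A := fun _ _ _ => True) .true (L := fun c I _ v => c ∈ I.lists v)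
    fun c => .mem c none).decidableInPolyTime fun I => I.graph.IsP5Free
  have e : (fun I : {I : RestrictedListInstance k // I.graph.IsP5Free} =>
      I.1.graph.IsListColourable I.1.lists) = fun I =>
      P5FreeColouring.Solvable I.1.graph k (fun _ => True) fun c v => c ∈ I.1.lists v :=
    funext fun I => propext (P5FreeColouring.solvable_iff I.1 I.2).symm
  rw [e]
  exact h
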